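/- Let $T>0$ and let $\mathcal P,\mathcal H,\mathcal M,\mathcal Q$ be real Hilbert spaces such that $\mathcal P\hookrightarrow\mathcal H\cong\mathcal H^*\hookrightarrow\mathcal P^*$ is a Gelfand triple, i.e. $\mathcal P$ is continuously and densely embedded in $\mathcal H$. Let $\mathcal A:\mathcal H\to\mathcal H^*$, $\mathcal K:\mathcal P\to\mathcal M^*$, $\mathcal D:\mathcal M\to\mathcal M^*$ and $\mathcal B:\mathcal P\to\mathcal Q^*$ be linear and bounded, and assume that - $\mathcal D$ is elliptic: there is $c_{\mathcal D}>0$ with $c_{\mathcal D}\|m\|_{\mathcal M}^2\le\langle\mathcal D m,m\rangle$ for all $m\in\mathcal M$; - $\mathcal B$ is inf-sup stable: there is $\beta>0$ with $\inf_{\mu\in\mathcal Q\setminus\{0\}}\sup_{q\in\mathcal P\setminus\{0\}}\frac{\langle\mathcal B q,\mu\rangle}{\|q\|_{\mathcal P}\|\mu\|_{\mathcal Q}}\ge\beta$ (an infimum over the empty set being $+\infty$); - there is $c_{\mathcal K}>0$ with $c_{\mathcal K}\|q\|_{\mathcal P}\le\|\mathcal K q\|_{\mathcal M^*}$ for all $q\in\mathcal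 P_{\ker}:=\ker\mathcal B$. Let $\mathcal B^-:\mathcal Q^*\to\mathcal P$ denote the right inverse of $\mathcal B$ with values in $\mathcal P_{\ker}^{\perp}$ (the orthogonal complement in $\mathcal P$), and let $\mathcal H_{\ker}$ be the closure of $\mathcal P_{\ker}$ in $\mathcal H$. Let $f\in L^2(0,T;\mathcal M^*)$, $g\in L^2(0,T;\mathcal P^*)$, $h\in H^1(0,T;\mathcal Q^*)$, and let $p(0)\in\mathcal H$ be an initial value that is consistent, i.e. $p(0)-\mathcal B^-h(0)\in\mathcal H_{\ker}$. Then there is a unique triple $(p_0,m_0,\lambda_0)$ with $$p_0\in L^2(0,T;\mathcal P)\cap C([0,T],\mathcal H),\qquad m_0\in L^2(0,T;\mathcal M),\qquad \lambda_0\ \text{a } \mathcal Q\text{-valued distribution on }(0,T),$$ that is a weak solution of $$\dot p_0+\mathcal A p_0-\mathcal K^*m_0+\mathcal B^*\lambda_0=g\ \text{ in }\mathcal P^*,\qquad \mathcal K p_0+\mathcal D m_0=f\ \text{ in }\mathcal M^*,\qquad \mathcal B p_0=h\ \text{ in }\mathcal Q^*,\qquad p_0(0)=p(0),$$ where the first equation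 holds in the sense of $\mathcal P^*$-valued distributions on $(0,T)$, the second and third for almost every $t\in(0,T)$, and the initial condition for the continuous representative of $p_0$ in $\mathcal H$. Moreover $\dot p_0+\mathcal B^*\lambda_0\in L^2(0,T;\mathcal P^*)$. -/

import Mathlib

open MeasureTheory
open scoped Distributions LineDeriv ENNReal

namespace PDAE

noncomputable section

/-- The open time interval `(0, T)`. -/
def timeInterval (T : ℝ) : TopologicalSpace.Opens ℝ := ⟨Set.Ioo 0 T, isOpen_Ioo⟩

/-- Lebesgue measure on `(0, T)`. -/
abbrev timeMeasure (T : ℝ) : Measure ℝ := volume.restrict (Set.Ioo 0 T)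

/-- The Bochner space `L²(0,T;X)` (equivalence classes modulo equality almost everywhere). -/
abbrev L2 (T : ℝ) (X : Type*) [NormedAddCommGroup X] : Type _ := Lp X 2 (timeMeasure T)

section Bochner

variable {X : Type*} [NormedAddCommGroup X] [NormedSpace ℝ X] {T : ℝ}

/-- The regular `X`-valued distribution on `(0,T)` given by `u ∈ L²(0,T;X)`, that is
`φ ↦ ∫₀ᵀ φ(t) u(t) dt`. -/
def toDistribution (u : L2 T X) : 𝓓'(timeInterval T, X) :=
  ContinuousLinearMap.toUniformConvergenceCLM _ _ _
    (TestFunction.integralAgainstBilinCLM (ContinuousLinearMap.lsmul ℝ ℝ) (timeMeasure T) u)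

theorem toDistribution_apply (u : L2 T X) (φ : 𝓓(timeInterval T, ℝ)) :
    toDistribution u φ = ∫ t in Set.Ioo 0 T, φ t • u t := by
  have hu : Integrable (u : ℝ → X) (timeMeasure T) :=
    (Lp.memLp u).integrable (by norm_num)
  change TestFunction.integralAgainstBilinCLM (ContinuousLinearMap.lsmul ℝ ℝ)
    (timeMeasure T) u φ = _
  rw [TestFunction.integralAgainstBilinCLM_eq_integral
    (hu.locallyIntegrable.locallyIntegrableOn _)]
  rfl

/-- `u ∈ H¹(0,T;X)`: the distributional time derivative of `u` belongs to `L²(0,T;X)`. -/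
def MemH1 (u : L2 T X) : Prop :=
  ∃ u' : L2 T X, ∂_{(1 : ℝ)} (toDistribution u) = toDistribution u'

/-- The time-dependent function `u` is (a.e. equal to) an element `v` of `C([0,T], X)` and this
continuous representative satisfies `v(0) = x`. For `T > 0` the representative is unique
on `[0,T]`, so there is at most one such `x`. -/
def IsContinuousWithInitialValue (T : ℝ) (u : ℝ → X) (x : X) : Prop :=
  ∃ v : ℝ → X, ContinuousOn v (Set.Icc 0 T) ∧ u =ᵐ[timeMeasure T] v ∧ v 0 = x

end Bochner

section Operators

variable {P H M Q : Type*}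
  [NormedAddCommGroup P] [InnerProductSpace ℝ P]
  [NormedAddCommGroup H] [InnerProductSpace ℝ H]
  [NormedAddCommGroup M] [InnerProductSpace ℝ M]
  [NormedAddCommGroup Q] [InnerProductSpace ℝ Q]

/-- Ellipticity of `D : M → M*`. -/
def IsElliptic (D : M →L[ℝ] StrongDual ℝ M) : Prop :=
  ∃ c : ℝ, 0 < c ∧ ∀ m : M, c * ‖m‖ ^ 2 ≤ D m m

/-- Inf-sup stability of `B : P → Q*`:
`inf_{μ ≠ 0} sup_{q ≠ 0} ⟨B q, μ⟩ / (‖q‖ ‖μ‖) ≥ β` for some `β > 0`. -/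
def IsInfSupStable (B : P →L[ℝ] StrongDual ℝ Q) : Prop :=
  ∃ β : ℝ, 0 < β ∧
    ∀ μ : Q, μ ≠ 0 → β ≤ ⨆ q : {q : P // q ≠ 0}, B q μ / (‖(q : P)‖ * ‖μ‖)

/-- The kernel `P_ker = ker B`, a subspace of `P`. -/
def kerSpace (B : P →L[ℝ] StrongDual ℝ Q) : Submodule ℝ P := LinearMap.ker B.toLinearMap

/-- `H_ker`, the closure of (the image of) `P_ker` in `H`, where `ι : P → H` is the embedding. -/
def kerClosure (ι : P →L[ℝ] H) (B : P →L[ℝ] StrongDual ℝ Q) : Submodule ℝ H :=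
  ((kerSpace B).map ι.toLinearMap).topologicalClosure

/-- The right inverse `B⁻ : Q* → P` of `B`, that is the inverse of the restriction of `B` to the
orthogonal complement of `P_ker` (this restriction is bijective if `B` is inf-sup stable). -/
def rightInverse (B : P →L[ℝ] StrongDual ℝ Q) (x : StrongDual ℝ Q) : P :=
  (Function.invFun (fun q : (kerSpace B)ᗮ => B (q : P)) x : (kerSpace B)ᗮ)

/-- The embedding `H* → P*`, the restriction of functionals along `ι : P → H`. -/
def dualEmbedding (ι : P →L[ℝ] H) : StrongDual ℝ H →L[ℝ] StrongDual ℝ P :=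
  (ContinuousLinearMap.compL ℝ P H ℝ).flip ι

/-- The embedding `P → H ≅ H* → P*` of the Gelfand triple, `p ↦ (q ↦ (ι p, ι q)_H)`. -/
def gelfandEmbedding (ι : P →L[ℝ] H) : P →L[ℝ] StrongDual ℝ P :=
  dualEmbedding ι ∘L innerSL ℝ ∘L ι

theorem gelfandEmbedding_apply (ι : P →L[ℝ] H) (p q : P) :
    gelfandEmbedding ι p q = inner ℝ (ι p) (ι q) := rfl

/-- The operator `A : H → H*` regarded as an operator `P → P*`. -/
def restrictedOperator (ι : P →L[ℝ] H) (A : H →L[ℝ] StrongDual ℝ H) :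
    P →L[ℝ] StrongDual ℝ P :=
  dualEmbedding ι ∘L A ∘L ι

theorem restrictedOperator_apply (ι : P →L[ℝ] H) (A : H →L[ℝ] StrongDual ℝ H) (p q : P) :
    restrictedOperator ι A p q = A (ι p) (ι q) := rfl

/-- `∂ₜ p + B* lam`, as a distribution on `(0,T)` with values in `P*`. Here `p` is viewed as
`P*`-valued through the Gelfand triple, and `B* = B.flip : Q → P*`. -/
def derivAddMultiplier {T : ℝ} (ι : P →L[ℝ] H) (B : P →L[ℝ] StrongDual ℝ Q)
    (p : L2 T P) (lam : 𝓓'(timeInterval T, Q)) :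
    𝓓'(timeInterval T, StrongDual ℝ P) :=
  ∂_{(1 : ℝ)} (Distribution.mapCLM (gelfandEmbedding ι) (toDistribution p))
    + Distribution.mapCLM B.flip lam

/-- `(p, m, lam)` is a weak solution, with `p ∈ L²(0,T;P) ∩ C([0,T],H)`, `m ∈ L²(0,T;M)` and `lam`
a `Q`-valued distribution on `(0,T)`, of
* `∂ₜ p + A p - K* m + B* lam = g` in `P*`,
* `K p + D m = f` in `M*`,
* `B p = h` in `Q*`,
* `p(0) = pInit` in `H`.

The first equation holds in the sense of `P*`-valued distributions on `(0,T)`, the next two hold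
for almost every time; `K* = K.flip : M → P*`. -/
structure IsWeakSolution {T : ℝ} (ι : P →L[ℝ] H)
    (A : H →L[ℝ] StrongDual ℝ H) (K : P →L[ℝ] StrongDual ℝ M)
    (D : M →L[ℝ] StrongDual ℝ M) (B : P →L[ℝ] StrongDual ℝ Q)
    (f : L2 T (StrongDual ℝ M)) (g : L2 T (StrongDual ℝ P)) (h : L2 T (StrongDual ℝ Q))
    (pInit : H)
    (p : L2 T P) (m : L2 T M) (lam : 𝓓'(timeInterval T, Q)) : Prop where
  potential_eq :
    derivAddMultiplier ι B p lam
      + Distribution.mapCLM (restrictedOperator ι A) (toDistribution p)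
      - Distribution.mapCLM K.flip (toDistribution m) = toDistribution g
  flow_eq : ∀ᵐ t ∂(timeMeasure T), K (p t) + D (m t) = f t
  constraint_eq : ∀ᵐ t ∂(timeMeasure T), B (p t) = h t
  initial : IsContinuousWithInitialValue T (fun t => ι (p t)) pInit

end Operators

end

end PDAE

namespace PDAE

noncomputable section

/-! ### Primitives of integrable functions and the product rule for bilinear maps. -/

section Primitive

variable {X Y Z : Type*} [NormedAddCommGroup X] [NormedSpace ℝ X]
  [NormedAddCommGroup Y] [NormedSpace ℝ Y] [NormedAddCommGroup Z] [NormedSpace ℝ Z]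

/-! Two unknowns can be eliminated. Ellipticity makes `D` invertible (Lax–Milgram), so `m = D⁻¹(f -
K p)`. Inf-sup stability gives a bounded right inverse `S = B⁻`, and `p = u + S h` with `u` valued
in `ker B`; functionals on `ker B` do not see `B* lam`. What remains is a parabolic problem for `u`
on the Hilbert space `V = ker B` with operator `A + K* D⁻¹ K`. By the ellipticity of `D` and the
lower bound for `K` on `ker B`, this operator satisfies a Gårding inequality
(`kerOperator_garding`), and consistency says exactly that the initial value of `u` lies in the
closure of `V` in `H`.

With `j : V → H` the embedding and Riesz representatives in place of functionals, the problem reads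
`(j* j u)' + a u = F`. Existence is by density: regular paths `x₀ + ∫ w` with `w` in `L²` satisfy an
energy estimate in `L²(0,T;V)` and in the sup norm of `H`, in terms of forcing and initial value
(`exists_regular_bound`). Their data are dense, since a function orthogonal to all forcings yields a
solution of the homogeneous backward adjoint problem, hence vanishes
(`closure_range_regularForcing_zero`). Limits of regular paths inherit the equation, the continuity
in `H` and the initial value.

Uniqueness needs no energy identity for weak solutions: the time integral of a homogeneous weak
solution is a regular path solving the same equation, and the energy estimate applies to it.

Finally, the residual of the first equation annihilates `ker B`, hence equals `B* lam` for `lam = R`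
applied to it, where `R` is dual to `S`; as `R` is also a left inverse of `B*`, `lam` is unique. The
regularity of `∂ₜ p + B* lam` is read off the first equation. -/

/-- The primitive `t ↦ ∫_{(-∞, t]} f dμ`. -/
def primitive (μ : Measure ℝ) (f : ℝ → X) (t : ℝ) : X := ∫ s in Set.Iic t, f s ∂μ

theorem continuous_primitive {μ : Measure ℝ} [NullSingletonClass μ] {f : ℝ → X}
    (hf : Integrable f μ) :
    Continuous (primitive μ f) := by
  have h : primitive μ f = fun t => (∫ s in Set.Iic (0 : ℝ), f s ∂μ) + ∫ s in (0 : ℝ)..t, f s ∂μ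
    := by
    funext t
    rw [primitive, ← intervalIntegral.integral_Iic_sub_Iic hf.integrableOn hf.integrableOn]
    abel
  rw [h]
  exact continuous_const.add (intervalIntegral.continuous_primitive
    (fun a b => hf.intervalIntegrable) 0)

theorem norm_primitive_le {μ : Measure ℝ} {f : ℝ → X} (hf : Integrable f μ) (t : ℝ) :
    ‖primitive μ f t‖ ≤ ∫ s, ‖f s‖ ∂μ :=
  (norm_integral_le_integral_norm _).trans
    (setIntegral_le_integral hf.norm (Filter.Eventually.of_forall fun _ => norm_nonneg _))

theorem primitive_add {μ : Measure ℝ} {f g : ℝ → X} (hf : Integrable f μ) (hg : Integrable g μ)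
    (t : ℝ) : primitive μ (fun s => f s + g s) t = primitive μ f t + primitive μ g t :=
  integral_add hf.integrableOn hg.integrableOn

theorem primitive_congr {μ : Measure ℝ} {f g : ℝ → X} (h : f =ᵐ[μ] g) (t : ℝ) :
    primitive μ f t = primitive μ g t :=
  integral_congr_ae (ae_restrict_of_ae h)

theorem primitive_restrict (μ : Measure ℝ) (f : ℝ → X) {s t : ℝ} (hst : s ≤ t) :
    primitive (μ.restrict (Set.Iic t)) f s = primitive μ f s := by
  rw [primitive, primitive, Measure.restrict_restrict measurableSet_Iic,
    Set.inter_eq_left.2 (Set.Iic_subset_Iic.2 hst)]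

theorem map_primitive [CompleteSpace X] [CompleteSpace Y] (L : X →L[ℝ] Y) {μ : Measure ℝ}
    {f : ℝ → X} (hf : Integrable f μ) (t : ℝ) :
    L (primitive μ f t) = primitive μ (fun s => L (f s)) t :=
  (L.integral_comp_comm hf.integrableOn).symm

theorem integrable_bilin_left (a : X →L[ℝ] Y →L[ℝ] Z) {μ : Measure ℝ} {f : ℝ → X} {y : ℝ → Y}
    (hf : Integrable f μ) (hy : Continuous y) {c : ℝ} (hc : ∀ s, ‖y s‖ ≤ c) :
    Integrable (fun s => a (f s) (y s)) μ := by
  refine (hf.norm.const_mul (‖a‖ * c)).mono'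
    (a.aestronglyMeasurable_comp₂ hf.aestronglyMeasurable hy.aestronglyMeasurable)
    (Filter.Eventually.of_forall fun s => ?_)
  calc ‖a (f s) (y s)‖ ≤ ‖a‖ * ‖f s‖ * ‖y s‖ := a.le_opNorm₂ _ _
    _ ≤ ‖a‖ * ‖f s‖ * c := by gcongr; exact hc s
    _ = ‖a‖ * c * ‖f s‖ := by ring

theorem integrable_bilin_right (a : X →L[ℝ] Y →L[ℝ] Z) {μ : Measure ℝ} {x : ℝ → X} {g : ℝ → Y}
    (hx : Continuous x) {c : ℝ} (hc : ∀ s, ‖x s‖ ≤ c) (hg : Integrable g μ) :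
    Integrable (fun s => a (x s) (g s)) μ :=
  integrable_bilin_left a.flip hg hx hc

/-- By Fubini the left side is a double integral of `a (f s) (g r)`. The two terms on the right are
the contributions of `r ≤ s` and of `s < r`. -/
theorem bilin_integral_integral [CompleteSpace X] [CompleteSpace Y] [CompleteSpace Z]
    (a : X →L[ℝ] Y →L[ℝ] Z) {ν : Measure ℝ} [SFinite ν] [NullSingletonClass ν] {f : ℝ → X}
      {g : ℝ → Y}
    (hf : Integrable f ν) (hg : Integrable g ν) :
    a (∫ s, f s ∂ν) (∫ s, g s ∂ν) =
      (∫ s, a (f s) (primitive ν g s) ∂ν) + ∫ s, a (primitive ν f s) (g s) ∂ν := by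
  have hΦ : Integrable (fun z : ℝ × ℝ => a (f z.1) (g z.2)) (ν.prod ν) := by
    refine hf.op_fst_snd (op := fun x y => a x y) ?_ ⟨‖a‖, fun x y => a.le_opNorm₂ x y⟩ hg
    exact a.continuous₂
  have hS : MeasurableSet {z : ℝ × ℝ | z.2 ≤ z.1} := measurableSet_le measurable_snd measurable_fst
  have htot : a (∫ s, f s ∂ν) (∫ s, g s ∂ν) = ∫ z, a (f z.1) (g z.2) ∂(ν.prod ν) := by
    rw [integral_prod _ hΦ]
    have h1 : ∀ s, ∫ r, a (f s) (g r) ∂ν = a (f s) (∫ r, g r ∂ν) := fun s =>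
      (a (f s)).integral_comp_comm hg
    simp only [h1]
    exact ((a.flip (∫ r, g r ∂ν)).integral_comp_comm hf).symm
  rw [htot, ← integral_add_compl hS hΦ]
  congr 1
  · rw [← integral_indicator hS, integral_prod _ (hΦ.indicator hS)]
    refine integral_congr_ae (Filter.Eventually.of_forall fun s => ?_)
    have h1 : (fun r => Set.indicator {z : ℝ × ℝ | z.2 ≤ z.1} (fun z => a (f z.1) (g z.2)) (s, r))
        = (Set.Iic s).indicator (fun r => a (f s) (g r)) := by
      funext r
      simp [Set.indicator]
    simp only [h1]
    rw [integral_indicator measurableSet_Iic]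
    exact (a (f s)).integral_comp_comm hg.integrableOn
  · rw [← integral_indicator hS.compl, integral_prod_symm _ (hΦ.indicator hS.compl)]
    refine integral_congr_ae (Filter.Eventually.of_forall fun r => ?_)
    have h1 : (fun s => Set.indicator {z : ℝ × ℝ | z.2 ≤ z.1}ᶜ (fun z => a (f z.1) (g z.2)) (s, r))
        = (Set.Iio r).indicator (fun s => a (f s) (g r)) := by
      funext s
      simp [Set.indicator]
    simp only [h1]
    -- The strict inequality from the complement becomes `≤` because the measure has no atoms.
    rw [integral_indicator measurableSet_Iio, primitive, integral_Iic_eq_integral_Iio]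
    exact (a.flip (g r)).integral_comp_comm hf.integrableOn

/-- The product rule for primitives, in integrated form. -/
theorem bilin_primitive [CompleteSpace X] [CompleteSpace Y] [CompleteSpace Z]
    (a : X →L[ℝ] Y →L[ℝ] Z) {μ : Measure ℝ} [SFinite μ] [NullSingletonClass μ] {f : ℝ → X}
      {g : ℝ → Y}
    (hf : Integrable f μ) (hg : Integrable g μ) (x₀ : X) (y₀ : Y) (t : ℝ) :
    a (x₀ + primitive μ f t) (y₀ + primitive μ g t) = a x₀ y₀ +
      primitive μ (fun s => a (f s) (y₀ + primitive μ g s) + a (x₀ + primitive μ f s) (g s)) t := by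
  have hf' : Integrable f (μ.restrict (Set.Iic t)) := hf.restrict
  have hg' : Integrable g (μ.restrict (Set.Iic t)) := hg.restrict
  -- Cutting the measure off at `t` turns total integrals into values of primitives at `t` and
  -- leaves the inner primitives unchanged for `s ≤ t`.
  have key := bilin_integral_integral a hf' hg'
  have e1 : ∫ s in Set.Iic t, a (f s) (primitive (μ.restrict (Set.Iic t)) g s) ∂μ
      = ∫ s in Set.Iic t, a (f s) (primitive μ g s) ∂μ :=
    setIntegral_congr_fun measurableSet_Iic fun s hs => by
      simp only [primitive_restrict μ g (Set.mem_Iic.1 hs)]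
  have e2 : ∫ s in Set.Iic t, a (primitive (μ.restrict (Set.Iic t)) f s) (g s) ∂μ
      = ∫ s in Set.Iic t, a (primitive μ f s) (g s) ∂μ :=
    setIntegral_congr_fun measurableSet_Iic fun s hs => by
      simp only [primitive_restrict μ f (Set.mem_Iic.1 hs)]
  rw [e1, e2] at key
  have i1 : Integrable (fun s => a (f s) (primitive μ g s)) (μ.restrict (Set.Iic t)) :=
    integrable_bilin_left a hf' (continuous_primitive hg) (norm_primitive_le hg)
  have i2 : Integrable (fun s => a (primitive μ f s) (g s)) (μ.restrict (Set.Iic t)) :=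
    integrable_bilin_right a (continuous_primitive hf) (norm_primitive_le hf) hg'
  have i3 : Integrable (fun s => a (f s) y₀) (μ.restrict (Set.Iic t)) :=
    (a.flip y₀).integrable_comp hf'
  have i4 : Integrable (fun s => a x₀ (g s)) (μ.restrict (Set.Iic t)) := (a x₀).integrable_comp hg'
  have e3 : primitive μ (fun s => a (f s) (y₀ + primitive μ g s) + a (x₀ + primitive μ f s) (g s)) t
      = (a (primitive μ f t) y₀ + ∫ s in Set.Iic t, a (f s) (primitive μ g s) ∂μ)
        + (a x₀ (primitive μ g t) + ∫ s in Set.Iic t, a (primitive μ f s) (g s) ∂μ) := by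
    have h3 : a (primitive μ f t) y₀ = ∫ s in Set.Iic t, a (f s) y₀ ∂μ :=
      ((a.flip y₀).integral_comp_comm hf').symm
    have h4 : a x₀ (primitive μ g t) = ∫ s in Set.Iic t, a x₀ (g s) ∂μ :=
      ((a x₀).integral_comp_comm hg').symm
    rw [h3, h4, ← integral_add i3 i1, ← integral_add i4 i2]
    refine Eq.trans ?_ (integral_add (i3.add i1) (i4.add i2))
    simp only [primitive, map_add, add_apply]
  rw [e3]
  have h5 : a (primitive μ f t) (primitive μ g t) = _ := key
  simp only [map_add, add_apply, h5]
  abel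

end Primitive

/-! ### Primitives on the time interval. -/

section TimeInterval

variable {T : ℝ} {X : Type*} [NormedAddCommGroup X]

theorem integrable_L2 (u : L2 T X) : Integrable u (timeMeasure T) :=
  (Lp.memLp u).integrable (by norm_num)

theorem primitive_final [NormedSpace ℝ X] (f : ℝ → X) :
    primitive (timeMeasure T) f T = ∫ s, f s ∂(timeMeasure T) := by
  rw [primitive, Measure.restrict_restrict measurableSet_Iic,
    Set.inter_eq_right.2 (fun s hs => hs.2.le)]

theorem primitive_initial [NormedSpace ℝ X] (f : ℝ → X) :
    primitive (timeMeasure T) f 0 = 0 := by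
  have h : Set.Iic (0 : ℝ) ∩ Set.Ioo 0 T = ∅ := by
    ext s
    simp only [Set.mem_inter_iff, Set.mem_Iic, Set.mem_Ioo, Set.mem_empty_iff_false, iff_false]
    rintro ⟨h1, h2, -⟩
    exact absurd h1 (not_le.2 h2)
  rw [primitive, Measure.restrict_restrict measurableSet_Iic, h, Measure.restrict_empty,
    integral_zero_measure]

theorem primitive_deriv [NormedSpace ℝ X] [CompleteSpace X] {φ φ' : ℝ → X}
    (h : ∀ t, HasDerivAt φ (φ' t) t) (hc : Continuous φ') {t : ℝ} (ht : t ∈ Set.Icc 0 T) :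
    primitive (timeMeasure T) φ' t = φ t - φ 0 := by
  have h1 : (Set.Iic t ∩ Set.Ioo 0 T : Set ℝ) =ᵐ[volume] Set.Ioc 0 t := by
    rcases eq_or_lt_of_le ht.2 with rfl | hlt
    · rw [Set.inter_eq_right.2 (fun s hs => hs.2.le)]
      exact Ioo_ae_eq_Ioc
    · have : Set.Iic t ∩ Set.Ioo 0 T = Set.Ioc 0 t := by
        ext s
        simp only [Set.mem_inter_iff, Set.mem_Iic, Set.mem_Ioo, Set.mem_Ioc]
        exact ⟨fun h => ⟨h.2.1, h.1⟩, fun h => ⟨h.2, h.1, h.2.trans_lt hlt⟩⟩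
      exact Filter.EventuallyEq.of_eq this
  rw [primitive, Measure.restrict_restrict measurableSet_Iic, setIntegral_congr_set h1,
    ← intervalIntegral.integral_of_le ht.1]
  exact intervalIntegral.integral_eq_sub_of_hasDerivAt (fun s _ => h s)
    (hc.intervalIntegrable _ _)

end TimeInterval

/-! ### Exponentially weighted energy identities. -/

section Energy

variable {T : ℝ} {V H : Type*} [NormedAddCommGroup V] [InnerProductSpace ℝ V] [CompleteSpace V]
  [NormedAddCommGroup H] [InnerProductSpace ℝ H] [CompleteSpace H]

theorem integrable_exp (T κ : ℝ) : Integrable (fun s => Real.exp (κ * s)) (timeMeasure T) :=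
  ((by fun_prop : Continuous fun s : ℝ => Real.exp (κ * s)).integrableOn_Icc
    (a := 0) (b := T)).mono_set Set.Ioo_subset_Icc_self

/-- The weighted energy identity for `y = y₀ + ∫ g`. -/
theorem exp_mul_norm_sq_primitive {g : ℝ → H} (hg : Integrable g (timeMeasure T))
    (y₀ : H) (κ : ℝ) {t : ℝ} (ht : t ∈ Set.Icc 0 T) :
    Real.exp (κ * t) * ‖y₀ + primitive (timeMeasure T) g t‖ ^ 2 = ‖y₀‖ ^ 2 +
      primitive (timeMeasure T) (fun s => Real.exp (κ * s) *
        (2 * inner ℝ (g s) (y₀ + primitive (timeMeasure T) g s)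
          + κ * ‖y₀ + primitive (timeMeasure T) g s‖ ^ 2)) t := by
  have hN : ∀ s, ‖y₀‖ ^ 2 + primitive (timeMeasure T)
      (fun r => 2 * inner ℝ (g r) (y₀ + primitive (timeMeasure T) g r)) s
      = ‖y₀ + primitive (timeMeasure T) g s‖ ^ 2 := fun s => by
    rw [← real_inner_self_eq_norm_sq, ← real_inner_self_eq_norm_sq]
    refine Eq.trans ?_ (bilin_primitive (innerSL ℝ) hg hg y₀ y₀ s).symm
    refine congrArg (_ + ·) (congrArg (primitive _ · _) ?_)
    funext r
    change _ = inner ℝ _ _ + inner ℝ _ _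
    rw [real_inner_comm (g r), two_mul]
  have hq : Integrable (fun r => 2 * inner ℝ (g r) (y₀ + primitive (timeMeasure T) g r))
      (timeMeasure T) :=
    (integrable_bilin_left (innerSL ℝ) hg (continuous_const.add (continuous_primitive hg))
      (fun s => (norm_add_le _ _).trans (add_le_add le_rfl (norm_primitive_le hg s)))).const_mul 2
  -- The weight is itself a constant plus a primitive, so the weighted energy is a product of two
  -- primitives and the product rule applies once more.
  have he : ∀ s ∈ Set.Icc 0 T, 1 + primitive (timeMeasure T) (fun r => κ * Real.exp (κ * r)) s
      = Real.exp (κ * s) := fun s hs => by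
    have hd : ∀ r, HasDerivAt (fun r => Real.exp (κ * r)) (κ * Real.exp (κ * r)) r := fun r => by
      have := ((hasDerivAt_id r).const_mul κ).exp
      simpa [mul_comm] using this
    rw [primitive_deriv (T := T) hd (by fun_prop) hs]
    simp
  have key := bilin_primitive (ContinuousLinearMap.mul ℝ ℝ) ((integrable_exp T κ).const_mul κ) hq
    1 (‖y₀‖ ^ 2) t
  simp only [ContinuousLinearMap.mul_apply', hN] at key
  rw [he t ht, one_mul] at key
  rw [key]
  congr 1
  refine integral_congr_ae (ae_restrict_of_ae ?_)
  filter_upwards [ae_restrict_mem measurableSet_Ioo] with s hs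
  rw [he s ⟨hs.1.le, hs.2.le⟩]
  ring

/-- The weighted energy identity for `x = x₀ + ∫ f`, in the norm of the pivot space. -/
theorem exp_mul_norm_sq_map_primitive (j : V →L[ℝ] H) {f : ℝ → V}
    (hf : Integrable f (timeMeasure T)) (x₀ : V) (κ : ℝ) {t : ℝ} (ht : t ∈ Set.Icc 0 T) :
    Real.exp (κ * t) * ‖j (x₀ + primitive (timeMeasure T) f t)‖ ^ 2 = ‖j x₀‖ ^ 2 +
      primitive (timeMeasure T) (fun s => Real.exp (κ * s) *
        (2 * inner ℝ (j (f s)) (j (x₀ + primitive (timeMeasure T) f s))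
          + κ * ‖j (x₀ + primitive (timeMeasure T) f s)‖ ^ 2)) t := by
  simpa only [map_add, map_primitive j hf] using
    exp_mul_norm_sq_primitive (j.integrable_comp hf) (j x₀) κ ht

end Energy

/-! ### Vector-valued distributions on `(0,T)` and their derivatives. -/

section Distributions

variable {T : ℝ} {X Y : Type*} [NormedAddCommGroup X] [NormedSpace ℝ X]
  [NormedAddCommGroup Y] [NormedSpace ℝ Y]

theorem integrable_testFunction_smul (u : L2 T X) (φ : 𝓓(timeInterval T, ℝ)) :
    Integrable (fun t => φ t • u t) (timeMeasure T) := by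
  obtain ⟨c, hc⟩ := φ.hasCompactSupport.exists_bound_of_continuous φ.continuous
  exact integrable_bilin_right (ContinuousLinearMap.lsmul ℝ ℝ) φ.continuous hc (integrable_L2 u)

theorem toDistribution_add (u v : L2 T X) :
    toDistribution (u + v) = toDistribution u + toDistribution v := by
  ext φ
  change toDistribution (u + v) φ = toDistribution u φ + toDistribution v φ
  simp only [toDistribution_apply]
  rw [← integral_add (integrable_testFunction_smul u φ) (integrable_testFunction_smul v φ)]
  refine integral_congr_ae ?_
  filter_upwards [Lp.coeFn_add u v] with t ht
  rw [ht, Pi.add_apply, smul_add]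

theorem mapCLM_toDistribution [CompleteSpace X] [CompleteSpace Y] (L : X →L[ℝ] Y) (u : L2 T X) :
    Distribution.mapCLM L (toDistribution u) = toDistribution (L.compLp u) := by
  ext φ
  rw [Distribution.mapCLM_apply, toDistribution_apply, toDistribution_apply,
    ← L.integral_comp_comm (integrable_testFunction_smul u φ)]
  refine integral_congr_ae ?_
  filter_upwards [L.coeFn_compLp u] with t ht
  rw [ht, map_smul]

theorem toDistribution_zero : toDistribution (0 : L2 T X) = 0 := by
  simpa using toDistribution_add (0 : L2 T X) 0

theorem toDistribution_sub (u v : L2 T X) :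
    toDistribution (u - v) = toDistribution u - toDistribution v := by
  rw [eq_sub_iff_add_eq, ← toDistribution_add, sub_add_cancel]

theorem lineDeriv_mapCLM (L : X →L[ℝ] Y) (S : 𝓓'(timeInterval T, X)) :
    ∂_{(1 : ℝ)} (Distribution.mapCLM L S) = Distribution.mapCLM L (∂_{(1 : ℝ)} S) := by
  ext φ
  simp

theorem testFunction_lineDeriv_apply (φ : 𝓓(timeInterval T, ℝ)) (t : ℝ) :
    (∂_{(1 : ℝ)} φ) t = deriv φ t := by
  rw [TestFunction.lineDerivOp_eq_lineDerivCLM ℝ, TestFunction.lineDerivCLM_apply, if_pos le_top]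
  have hd : DifferentiableAt ℝ φ t :=
    (φ.contDiff.differentiable (by simp)).differentiableAt
  rw [hd.lineDeriv_eq_fderiv, fderiv_eq_smul_deriv, one_smul]

theorem testFunction_eq_zero (φ : 𝓓(timeInterval T, ℝ)) {t : ℝ} (ht : t ∉ Set.Ioo 0 T) :
    φ t = 0 :=
  image_eq_zero_of_notMem_tsupport fun h => ht (φ.tsupport_subset h)

theorem integral_norm_le_mul_norm (T : ℝ) (X : Type*) [NormedAddCommGroup X] :
    ∃ c : ℝ, 0 ≤ c ∧ ∀ u : L2 T X, ∫ t, ‖u t‖ ∂(timeMeasure T) ≤ c * ‖u‖ := by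
  refine ⟨((timeMeasure T) Set.univ ^ (1 / (1 : ℝ≥0∞).toReal - 1 / (2 : ℝ≥0∞).toReal)).toReal,
    ENNReal.toReal_nonneg, fun u => ?_⟩
  have h := eLpNorm_le_eLpNorm_mul_rpow_measure_univ (μ := timeMeasure T) (f := u)
    (p := 1) (q := 2) (by norm_num) (Lp.aestronglyMeasurable u)
  rw [integral_norm_eq_lintegral_enorm (Lp.aestronglyMeasurable u), ←
    eLpNorm_one_eq_lintegral_enorm,
    Lp.norm_def, mul_comm, ← ENNReal.toReal_mul]
  refine ENNReal.toReal_mono (ENNReal.mul_ne_top (Lp.eLpNorm_ne_top u) ?_) h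
  exact ENNReal.rpow_ne_top_of_nonneg (by norm_num) (measure_ne_top _ _)

/-- A test function is bounded and the interval has finite length, so Hölder applies. This is what
lets distributional equations pass to `L²` limits. -/
theorem continuous_toDistribution_apply (φ : 𝓓(timeInterval T, ℝ)) :
    Continuous fun u : L2 T X => toDistribution u φ := by
  obtain ⟨c, hc⟩ := φ.hasCompactSupport.exists_bound_of_continuous φ.continuous
  obtain ⟨b, -, hb⟩ := integral_norm_le_mul_norm T X
  have hc0 : 0 ≤ c := (norm_nonneg _).trans (hc 0)
  refine (LipschitzWith.of_dist_le_mul (K := (c * b).toNNReal) fun u v => ?_).continuous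
  have h1 : toDistribution u φ - toDistribution v φ = toDistribution (u - v) φ := by
    rw [toDistribution_sub]
    rfl
  rw [dist_eq_norm, dist_eq_norm, h1, toDistribution_apply]
  calc ‖∫ t in Set.Ioo 0 T, φ t • (u - v : L2 T X) t‖
      ≤ ∫ t in Set.Ioo 0 T, c * ‖(u - v : L2 T X) t‖ := by
        refine norm_integral_le_of_norm_le ((integrable_L2 _).norm.const_mul c)
          (Filter.Eventually.of_forall fun t => ?_)
        rw [norm_smul]
        exact mul_le_mul_of_nonneg_right (hc t) (norm_nonneg _)
    _ = c * ∫ t in Set.Ioo 0 T, ‖(u - v : L2 T X) t‖ := integral_const_mul _ _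
    _ ≤ c * (b * ‖u - v‖) := mul_le_mul_of_nonneg_left (hb _) hc0
    _ = c * b * ‖u - v‖ := by ring
    _ ≤ (c * b).toNNReal * ‖u - v‖ :=
        mul_le_mul_of_nonneg_right (Real.le_coe_toNNReal _) (norm_nonneg _)

/-- The distributional derivative of a primitive. -/
theorem lineDeriv_toDistribution_primitive [CompleteSpace X] (hT : 0 < T) {U u : L2 T X} {x₀ : X}
    (hU : U =ᵐ[timeMeasure T] fun t => x₀ + primitive (timeMeasure T) u t) :
    ∂_{(1 : ℝ)} (toDistribution U) = toDistribution u := by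
  ext φ
  rw [Distribution.lineDerivOp_apply_apply, map_neg, toDistribution_apply, toDistribution_apply]
  have hd : ∀ t, HasDerivAt φ (deriv φ t) t := fun t =>
    (φ.contDiff.differentiable (by simp)).differentiableAt.hasDerivAt
  have hc : Continuous (deriv φ) := φ.contDiff.continuous_deriv (by simp)
  have hu := integrable_L2 u
  have hφ' : Integrable (deriv φ) (timeMeasure T) :=
    (hc.integrableOn_Icc (a := 0) (b := T)).mono_set Set.Ioo_subset_Icc_self
  have hφ : ∀ t ∈ Set.Icc 0 T, primitive (timeMeasure T) (deriv φ) t = φ t := fun t ht => by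
    rw [primitive_deriv hd hc ht, testFunction_eq_zero φ (t := 0) (by simp), sub_zero]
  -- Integration by parts: `φ` is the primitive of `deriv φ` because it vanishes at `0`, and there
  -- is no boundary term because it vanishes at `T`.
  have key := bilin_primitive (ContinuousLinearMap.lsmul ℝ ℝ) hφ' hu 0 x₀ T
  rw [hφ T ⟨hT.le, le_rfl⟩, testFunction_eq_zero φ (t := T) (by simp)] at key
  simp only [ContinuousLinearMap.lsmul_apply, zero_add, map_zero, zero_apply] at key
  rw [primitive_final] at key
  obtain ⟨c, hcb⟩ := φ.hasCompactSupport.exists_bound_of_continuous φ.continuous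
  have i1 : Integrable (fun t => deriv φ t • (x₀ + primitive (timeMeasure T) u t))
      (timeMeasure T) :=
    integrable_bilin_left (ContinuousLinearMap.lsmul ℝ ℝ) hφ'
      (continuous_const.add (continuous_primitive hu))
      (fun s => (norm_add_le _ _).trans (add_le_add le_rfl (norm_primitive_le hu s)))
  have e1 : ∫ t, (deriv φ t • (x₀ + primitive (timeMeasure T) u t)
        + primitive (timeMeasure T) (deriv φ) t • u t) ∂(timeMeasure T)
      = ∫ t, (deriv φ t • (x₀ + primitive (timeMeasure T) u t) + φ t • u t) ∂(timeMeasure T) := by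
    refine integral_congr_ae ?_
    filter_upwards [ae_restrict_mem measurableSet_Ioo] with s hs
    rw [hφ s ⟨hs.1.le, hs.2.le⟩]
  rw [e1, integral_add i1 (integrable_testFunction_smul u φ)] at key
  have e2 : ∫ t in Set.Ioo 0 T, (∂_{(1 : ℝ)} φ) t • U t
      = ∫ t, deriv φ t • (x₀ + primitive (timeMeasure T) u t) ∂(timeMeasure T) := by
    refine integral_congr_ae ?_
    filter_upwards [hU] with t ht
    rw [ht, testFunction_lineDeriv_apply]
  rw [e2]
  exact neg_eq_of_add_eq_zero_right key.symm

/-- The primitive from the left vanishes before the support of `ψ`, and after it because `ψ` has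
mean zero; hence it is a test function. -/
theorem exists_testFunction_deriv_eq {ψ : ℝ → ℝ} (hψ : ContDiff ℝ (⊤ : ℕ∞) ψ)
    (hc : HasCompactSupport ψ) (hs : tsupport ψ ⊆ Set.Ioo 0 T) (h0 : ∫ t, ψ t = 0) :
    ∃ φ : 𝓓(timeInterval T, ℝ), ∀ t, deriv φ t = ψ t := by
  have hint : Integrable ψ := hψ.continuous.integrable_of_hasCompactSupport hc
  have hd : ∀ t, HasDerivAt (primitive volume ψ) (ψ t) t := fun t => by
    have h : primitive volume ψ
        = fun t => (∫ s in Set.Iic (0 : ℝ), ψ s) + ∫ s in (0 : ℝ)..t, ψ s := by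
      funext t
      rw [primitive, ← intervalIntegral.integral_Iic_sub_Iic hint.integrableOn hint.integrableOn]
      abel
    rw [h]
    exact (hψ.continuous.integral_hasStrictDerivAt 0 t).hasDerivAt.const_add _
  have hderiv : deriv (primitive volume ψ) = ψ := funext fun t => (hd t).deriv
  obtain ⟨lo, hi, hlo, hhi⟩ : ∃ lo hi : ℝ, tsupport ψ ⊆ Set.Icc lo hi ∧
      Set.Icc lo hi ⊆ Set.Ioo 0 T := by
    rcases (tsupport ψ).eq_empty_or_nonempty with he | hne
    -- For empty support the reversed endpoints give an empty interval.
    · exact ⟨1, 0, by simp [he], by simp⟩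
    · obtain ⟨lo, hlo, hlo'⟩ := hc.isCompact.exists_isLeast hne
      obtain ⟨hi, hhi, hhi'⟩ := hc.isCompact.exists_isGreatest hne
      exact ⟨lo, hi, fun x hx => ⟨hlo' hx, hhi' hx⟩,
        fun x hx => ⟨(hs hlo).1.trans_le hx.1, hx.2.trans_lt (hs hhi).2⟩⟩
  have hψ0 : ∀ t, t ∉ Set.Icc lo hi → ψ t = 0 := fun t ht =>
    image_eq_zero_of_notMem_tsupport fun h => ht (hlo h)
  have hsupp : Function.support (primitive volume ψ) ⊆ Set.Icc lo hi := by
    intro t ht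
    by_contra hn
    refine ht ?_
    rcases lt_or_ge t lo with h1 | h1
    · exact setIntegral_eq_zero_of_forall_eq_zero fun s hs' =>
        hψ0 s fun h => absurd (h.1.trans (Set.mem_Iic.1 hs')) (not_le.2 h1)
    · have h2 : hi < t := lt_of_not_ge fun h => hn ⟨h1, h⟩
      rw [primitive, setIntegral_eq_integral_of_forall_compl_eq_zero, h0]
      intro s hs'
      exact hψ0 s fun h => hs' (h.2.trans h2.le)
  have hts : tsupport (primitive volume ψ) ⊆ Set.Icc lo hi :=
    closure_minimal hsupp isClosed_Icc
  refine
    ⟨⟨primitive volume ψ, ?_, HasCompactSupport.of_support_subset_isCompact isCompact_Icc hsupp,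
    hts.trans hhi⟩, fun t => (hd t).deriv⟩
  exact contDiff_infty_iff_deriv.2 ⟨fun t => (hd t).differentiableAt, by rwa [hderiv]⟩

/-- A function with vanishing distributional derivative is constant. -/
theorem ae_eq_const_of_lineDeriv_eq_zero [CompleteSpace X] (hT : 0 < T) {y : L2 T X}
    (hy : ∂_{(1 : ℝ)} (toDistribution y) = 0) : ∃ c : X, ∀ᵐ t ∂(timeMeasure T), y t = c := by
  -- Any bump of integral one supported inside `(0,T)` serves; the constant value of `y` is then the
  -- average of `y` weighted by it.
  let b : ContDiffBump (T / 2) := ⟨T / 8, T / 4, by linarith, by linarith⟩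
  set θ : ℝ → ℝ := b.normed volume with hθ
  have hθd : ContDiff ℝ (⊤ : ℕ∞) θ := b.contDiff_normed
  have hθc : HasCompactSupport θ := b.hasCompactSupport_normed
  have hθs : tsupport θ ⊆ Set.Ioo 0 T := by
    rw [hθ, b.tsupport_normed_eq, Real.closedBall_eq_Icc]
    intro t ht
    have h1 : T / 2 - T / 4 ≤ t := ht.1
    have h2 : t ≤ T / 2 + T / 4 := ht.2
    constructor <;> linarith
  have hθ1 : ∫ t, θ t = 1 := b.integral_normed
  have hyi := integrable_L2 y
  have hi : ∀ g : ℝ → ℝ, Continuous g → HasCompactSupport g →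
      Integrable (fun t => g t • y t) (timeMeasure T) := fun g hg hgc => by
    obtain ⟨c, hc⟩ := hgc.exists_bound_of_continuous hg
    exact integrable_bilin_right (ContinuousLinearMap.lsmul ℝ ℝ) hg hc hyi
  refine ⟨∫ t, θ t • y t ∂(timeMeasure T), ?_⟩
  set c := ∫ t, θ t • y t ∂(timeMeasure T) with hc
  have hloc : LocallyIntegrableOn (fun t => y t - c) (Set.Ioo 0 T) volume :=
    IntegrableOn.locallyIntegrableOn (hyi.sub (integrable_const c))
  have := isOpen_Ioo.ae_eq_zero_of_integral_contDiff_smul_eq_zero hloc fun g hg hgc hgs => by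
    have hgi : Integrable g := hg.continuous.integrable_of_hasCompactSupport hgc
    have hθi : Integrable θ := hθd.continuous.integrable_of_hasCompactSupport hθc
    have hsub : tsupport (fun t => g t - (∫ s, g s) * θ t) ⊆ tsupport g ∪ tsupport θ := by
      refine closure_minimal (fun t ht => ?_) ((isClosed_tsupport g).union (isClosed_tsupport θ))
      by_contra hn
      rw [Set.mem_union, not_or] at hn
      exact ht (by simp [image_eq_zero_of_notMem_tsupport hn.1,
        image_eq_zero_of_notMem_tsupport hn.2])
    -- Subtracting a multiple of the bump makes the mean zero, so the result is the derivative of a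
    -- test function and `y` integrates to zero against it.
    obtain ⟨φ, hφ⟩ := exists_testFunction_deriv_eq (T := T) (ψ := fun t => g t - (∫ s, g s) * θ t)
      (hg.sub (contDiff_const.mul hθd))
      (HasCompactSupport.of_support_subset_isCompact (hgc.isCompact.union hθc.isCompact)
        ((subset_tsupport _).trans hsub))
      (hsub.trans (Set.union_subset hgs hθs))
      (by rw [integral_sub hgi (hθi.const_mul _), integral_const_mul, hθ1, mul_one, sub_self])
    have h1 : toDistribution y (∂_{(1 : ℝ)} φ) = 0 := by
      have := congrArg (fun S : 𝓓'(timeInterval T, X) => S φ) hy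
      simpa [map_neg] using this
    rw [toDistribution_apply] at h1
    simp only [testFunction_lineDeriv_apply, hφ, sub_smul, mul_smul] at h1
    have hsm : Integrable (fun t => (∫ s, g s) • θ t • y t) (timeMeasure T) :=
      (hi θ hθd.continuous hθc).smul (∫ s, g s)
    rw [integral_sub (hi g hg.continuous hgc) hsm, integral_smul] at h1
    have h2 : ∫ t, g t • (y t - c) = ∫ t in Set.Ioo 0 T, g t • (y t - c) :=
      (setIntegral_eq_integral_of_forall_compl_eq_zero fun t ht => by
        rw [image_eq_zero_of_notMem_tsupport fun h => ht (hgs h), zero_smul]).symm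
    have h3 : ∫ t in Set.Ioo 0 T, g t = ∫ t, g t :=
      setIntegral_eq_integral_of_forall_compl_eq_zero fun t ht =>
        image_eq_zero_of_notMem_tsupport fun h => ht (hgs h)
    rw [h2]
    simp only [smul_sub]
    rw [integral_sub (hi g hg.continuous hgc) (hgi.restrict.smul_const c), integral_smul_const, h3]
    exact h1
  rw [ae_restrict_iff' measurableSet_Ioo]
  filter_upwards [this] with t ht hmem
  exact sub_eq_zero.1 (ht hmem)

end Distributions

section Integrability

variable {T : ℝ} {X : Type*} [NormedAddCommGroup X]

theorem integrable_of_continuous {y : ℝ → X} (hy : Continuous y) :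
    Integrable y (timeMeasure T) :=
  (hy.integrableOn_Icc (a := 0) (b := T)).mono_set Set.Ioo_subset_Icc_self

theorem ae_eq_zero_of_integral_exp_mul_nonpos {x : ℝ → X} (hx : Continuous x) (κ : ℝ)
    (h : ∫ s, Real.exp (κ * s) * ‖x s‖ ^ 2 ∂(timeMeasure T) ≤ 0) :
    ∀ᵐ s ∂(timeMeasure T), x s = 0 := by
  have h0 : ∀ s, 0 ≤ Real.exp (κ * s) * ‖x s‖ ^ 2 := fun s => by positivity
  have hi : Integrable (fun s => Real.exp (κ * s) * ‖x s‖ ^ 2) (timeMeasure T) :=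
    integrable_of_continuous (by fun_prop)
  have := (integral_eq_zero_iff_of_nonneg h0 hi).1 (le_antisymm h (integral_nonneg h0))
  filter_upwards [this] with s hs
  simpa [Real.exp_ne_zero] using hs

variable [NormedSpace ℝ X]

theorem continuous_add_primitive {f : ℝ → X} (hf : Integrable f (timeMeasure T)) (x₀ : X) :
    Continuous fun t => x₀ + primitive (timeMeasure T) f t :=
  continuous_const.add (continuous_primitive hf)

theorem norm_add_primitive_le {f : ℝ → X} (hf : Integrable f (timeMeasure T)) (x₀ : X) (t : ℝ) :
    ‖x₀ + primitive (timeMeasure T) f t‖ ≤ ‖x₀‖ + ∫ s, ‖f s‖ ∂(timeMeasure T) :=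
  (norm_add_le _ _).trans (add_le_add le_rfl (norm_primitive_le hf t))

end Integrability

theorem integrable_exp_mul_energy {T : ℝ} {V H : Type*} [NormedAddCommGroup V]
    [InnerProductSpace ℝ V] [NormedAddCommGroup H] [InnerProductSpace ℝ H] (j : V →L[ℝ] H)
      {f : ℝ → V} (hf : Integrable f (timeMeasure T))
    (x₀ : V) (κ : ℝ) : Integrable (fun s => Real.exp (κ * s) *
        (2 * inner ℝ (j (f s)) (j (x₀ + primitive (timeMeasure T) f s))
          + κ * ‖j (x₀ + primitive (timeMeasure T) f s)‖ ^ 2)) (timeMeasure T) := by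
  have hc := continuous_add_primitive hf x₀
  have h1 : Integrable (fun s => inner ℝ (j (f s)) (j (x₀ + primitive (timeMeasure T) f s)))
      (timeMeasure T) :=
    integrable_bilin_left (innerSL ℝ) (j.integrable_comp hf) (j.continuous.comp hc)
      (fun s => (j.le_opNorm _).trans
        (mul_le_mul_of_nonneg_left (norm_add_primitive_le hf x₀ s) (norm_nonneg j)))
  have h2 : Integrable (fun s => κ * ‖j (x₀ + primitive (timeMeasure T) f s)‖ ^ 2)
      (timeMeasure T) :=
    integrable_of_continuous (by fun_prop)
  refine Integrable.bdd_mul (c := Real.exp (|κ| * |T|)) ((h1.const_mul 2).add h2)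
    (by fun_prop : Continuous fun s : ℝ => Real.exp (κ * s)).aestronglyMeasurable ?_
  filter_upwards [ae_restrict_mem measurableSet_Ioo] with s hs
  rw [Real.norm_eq_abs, Real.abs_exp, Real.exp_le_exp]
  calc κ * s ≤ |κ * s| := le_abs_self _
    _ = |κ| * s := by rw [abs_mul, abs_of_pos hs.1]
    _ ≤ |κ| * |T| := by
        gcongr
        exact hs.2.le.trans (le_abs_self T)

/-! ### Energy estimate and homogeneous problems for regular paths. -/

section Parabolic

variable {T : ℝ} {V H : Type*} [NormedAddCommGroup V] [InnerProductSpace ℝ V] [CompleteSpace V]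
  [NormedAddCommGroup H] [InnerProductSpace ℝ H] [CompleteSpace H]

theorem inner_adjoint_comp_self (j : V →L[ℝ] H) (v w : V) :
    inner ℝ ((j.adjoint ∘L j) v) w = inner ℝ (j v) (j w) := by
  rw [ContinuousLinearMap.comp_apply, ContinuousLinearMap.adjoint_inner_left]

/-- The energy estimate for the regular solution `x = x₀ + ∫ f` of `j* j x' + a x = F`. -/
theorem energy_estimate (j : V →L[ℝ] H) (a : V →L[ℝ] V) {α C : ℝ} (hα : 0 < α) (hC : 0 ≤ C)
    (ha : ∀ v, α * ‖v‖ ^ 2 ≤ inner ℝ (a v) v + C * ‖j v‖ ^ 2)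
    {f : ℝ → V} (hf : Integrable f (timeMeasure T)) (x₀ : V) (F : L2 T V)
    (hF : ∀ᵐ s ∂(timeMeasure T),
      (j.adjoint ∘L j) (f s) + a (x₀ + primitive (timeMeasure T) f s) = F s)
    {t : ℝ} (ht : t ∈ Set.Icc 0 T) :
    Real.exp (-2 * C * t) * ‖j (x₀ + primitive (timeMeasure T) f t)‖ ^ 2
      + α * primitive (timeMeasure T)
          (fun s => Real.exp (-2 * C * s) * ‖x₀ + primitive (timeMeasure T) f s‖ ^ 2) t
      ≤ ‖j x₀‖ ^ 2 + α⁻¹ * ‖F‖ ^ 2 := by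
  have hc := continuous_add_primitive hf x₀
  have hFi : Integrable (fun s => ‖F s‖ ^ 2) (timeMeasure T) :=
    (Lp.memLp F).integrable_norm_pow (by norm_num)
  have hei : Integrable (fun s => Real.exp (-2 * C * s) *
      ‖x₀ + primitive (timeMeasure T) f s‖ ^ 2) (timeMeasure T) :=
    integrable_of_continuous (by fun_prop)
  have hFn : ∫ s, ‖F s‖ ^ 2 ∂(timeMeasure T) = ‖F‖ ^ 2 := by
    rw [← real_inner_self_eq_norm_sq F, L2.inner_def]
    simp only [real_inner_self_eq_norm_sq]
  have hFt : primitive (timeMeasure T) (fun s => ‖F s‖ ^ 2) t ≤ ‖F‖ ^ 2 := by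
    rw [← hFn]
    exact setIntegral_le_integral hFi (Filter.Eventually.of_forall fun s => sq_nonneg _)
  rw [exp_mul_norm_sq_map_primitive j hf x₀ (-2 * C) ht]
  have hle : primitive (timeMeasure T) (fun s => Real.exp (-2 * C * s) *
        (2 * inner ℝ (j (f s)) (j (x₀ + primitive (timeMeasure T) f s))
          + -2 * C * ‖j (x₀ + primitive (timeMeasure T) f s)‖ ^ 2)) t
      ≤ primitive (timeMeasure T) (fun s => α⁻¹ * ‖F s‖ ^ 2 -
        α * (Real.exp (-2 * C * s) * ‖x₀ + primitive (timeMeasure T) f s‖ ^ 2)) t := by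
    refine integral_mono_ae (integrable_exp_mul_energy j hf x₀ (-2 * C)).restrict
      ((hFi.const_mul _).sub (hei.const_mul _)).restrict (ae_restrict_of_ae ?_)
    filter_upwards [hF, ae_restrict_mem measurableSet_Ioo] with s hs hmem
    set x := x₀ + primitive (timeMeasure T) f s
    have h1 : inner ℝ (j (f s)) (j x) = inner ℝ (F s) x - inner ℝ (a x) x := by
      rw [← inner_adjoint_comp_self, ← inner_sub_left, ← hs, add_sub_cancel_right]
    have h2 := real_inner_le_norm (F s) x
    -- Young's inequality: half of the coercive term `2 α ‖x‖²` absorbs the forcing.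
    have h3 : 2 * (‖F s‖ * ‖x‖) ≤ α⁻¹ * ‖F s‖ ^ 2 + α * ‖x‖ ^ 2 := by
      have h4 : 0 ≤ α⁻¹ * (‖F s‖ - α * ‖x‖) ^ 2 := by positivity
      have h5 : α⁻¹ * (‖F s‖ - α * ‖x‖) ^ 2
          = α⁻¹ * ‖F s‖ ^ 2 + α * ‖x‖ ^ 2 - 2 * (‖F s‖ * ‖x‖) := by
        field_simp
        ring
      linarith
    have h6 : 2 * inner ℝ (j (f s)) (j x) + -2 * C * ‖j x‖ ^ 2
        ≤ α⁻¹ * ‖F s‖ ^ 2 - α * ‖x‖ ^ 2 := by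
      have := ha x
      linarith
    have he1 : Real.exp (-2 * C * s) ≤ 1 := by
      rw [Real.exp_le_one_iff]
      have := mul_nonneg hC hmem.1.le
      linarith
    calc Real.exp (-2 * C * s) * (2 * inner ℝ (j (f s)) (j x) + -2 * C * ‖j x‖ ^ 2)
        ≤ Real.exp (-2 * C * s) * (α⁻¹ * ‖F s‖ ^ 2 - α * ‖x‖ ^ 2) :=
          mul_le_mul_of_nonneg_left h6 (Real.exp_pos _).le
      _ = Real.exp (-2 * C * s) * (α⁻¹ * ‖F s‖ ^ 2)
          - α * (Real.exp (-2 * C * s) * ‖x‖ ^ 2) := by ring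
      _ ≤ 1 * (α⁻¹ * ‖F s‖ ^ 2) - α * (Real.exp (-2 * C * s) * ‖x‖ ^ 2) := by gcongr
      _ = _ := by rw [one_mul]
  have hsplit : primitive (timeMeasure T) (fun s => α⁻¹ * ‖F s‖ ^ 2 -
        α * (Real.exp (-2 * C * s) * ‖x₀ + primitive (timeMeasure T) f s‖ ^ 2)) t
      = α⁻¹ * primitive (timeMeasure T) (fun s => ‖F s‖ ^ 2) t
        - α * primitive (timeMeasure T) (fun s => Real.exp (-2 * C * s) *
            ‖x₀ + primitive (timeMeasure T) f s‖ ^ 2) t := by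
    simp only [primitive] at hei ⊢
    rw [integral_sub (hFi.const_mul _).restrict (hei.const_mul _).restrict, integral_const_mul,
      integral_const_mul]
  have := mul_le_mul_of_nonneg_left hFt (inv_nonneg.2 hα.le)
  linarith

/-- The forward homogeneous problem with zero initial value has only the zero solution. -/
theorem eq_zero_of_homogeneous (hT : 0 < T) (j : V →L[ℝ] H) (hj : Function.Injective j)
    (a : V →L[ℝ] V) {α C : ℝ} (hα : 0 < α) (hC : 0 ≤ C)
    (ha : ∀ v, α * ‖v‖ ^ 2 ≤ inner ℝ (a v) v + C * ‖j v‖ ^ 2) {f : ℝ → V}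
    (hf : Integrable f (timeMeasure T))
    (hF : ∀ᵐ s ∂(timeMeasure T),
      (j.adjoint ∘L j) (f s) + a (primitive (timeMeasure T) f s) = 0) :
    ∀ᵐ s ∂(timeMeasure T), f s = 0 := by
  have key := energy_estimate j a hα hC ha hf 0 (0 : L2 T V) (t := T) (by
    filter_upwards [hF, Lp.coeFn_zero V 2 (timeMeasure T)] with s hs h0
    rw [h0, zero_add, hs, Pi.zero_apply]) ⟨hT.le, le_rfl⟩
  simp only [zero_add, map_zero, norm_zero, zero_pow two_ne_zero, mul_zero] at key
  rw [primitive_final (fun s => Real.exp (-2 * C * s) * ‖primitive (timeMeasure T) f s‖ ^ 2)]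
    at key
  have h1 : ∫ s, Real.exp (-2 * C * s) * ‖primitive (timeMeasure T) f s‖ ^ 2 ∂(timeMeasure T)
      ≤ 0 := by
    have h2 : 0 ≤ Real.exp (-2 * C * T) * ‖j (primitive (timeMeasure T) f T)‖ ^ 2 := by positivity
    by_contra hn
    have := mul_pos hα (not_le.1 hn)
    linarith
  filter_upwards [hF, ae_eq_zero_of_integral_exp_mul_nonpos (continuous_primitive hf) _ h1]
    with s hs hs0
  rw [hs0, map_zero, add_zero] at hs
  have h3 : inner ℝ (j (f s)) (j (f s)) = 0 := by
    rw [← inner_adjoint_comp_self, hs, inner_zero_left]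
  exact hj (by rw [inner_self_eq_zero.1 h3, map_zero])

/-- The backward homogeneous adjoint problem with zero final value has only the zero solution. -/
theorem eq_zero_of_backward_homogeneous (hT : 0 < T) (j : V →L[ℝ] H) (hj : Function.Injective j)
    (a : V →L[ℝ] V) {α C : ℝ} (hα : 0 < α)
    (ha : ∀ v, α * ‖v‖ ^ 2 ≤ inner ℝ (a v) v + C * ‖j v‖ ^ 2) {f : ℝ → V}
    (hf : Integrable f (timeMeasure T)) {x₀ : V}
    (hfin : x₀ + primitive (timeMeasure T) f T = 0)
    (hF : ∀ᵐ s ∂(timeMeasure T),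
      (j.adjoint ∘L j) (f s) = a.adjoint (x₀ + primitive (timeMeasure T) f s)) :
    ∀ᵐ s ∂(timeMeasure T), f s = 0 := by
  have hc := continuous_add_primitive hf x₀
  have key := exp_mul_norm_sq_map_primitive j hf x₀ (2 * C) (t := T) ⟨hT.le, le_rfl⟩
  rw [hfin, map_zero, norm_zero, zero_pow two_ne_zero, mul_zero, primitive_final] at key
  have hei : Integrable (fun s => Real.exp (2 * C * s) *
      ‖x₀ + primitive (timeMeasure T) f s‖ ^ 2) (timeMeasure T) :=
    integrable_of_continuous (by fun_prop)
  -- The energy identity with zero final value reads `0 = ‖j x₀‖² + ∫ ...`. The backward sign of the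
  -- equation and the growing weight make the integrand at least `2 α` times the weighted `‖x‖²`, so
  -- the path vanishes.
  have hle := integral_mono_ae (hei.const_mul (2 * α)) (integrable_exp_mul_energy j hf x₀ (2 * C))
    (by
      filter_upwards [hF] with s hs
      set x := x₀ + primitive (timeMeasure T) f s
      have h1 : inner ℝ (j (f s)) (j x) = inner ℝ (a x) x := by
        rw [← inner_adjoint_comp_self, hs, ContinuousLinearMap.adjoint_inner_left, real_inner_comm]
      have h2 := ha x
      rw [h1]
      calc 2 * α * (Real.exp (2 * C * s) * ‖x‖ ^ 2)
          = Real.exp (2 * C * s) * (2 * (α * ‖x‖ ^ 2)) := by ring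
        _ ≤ Real.exp (2 * C * s) * (2 * inner ℝ (a x) x + 2 * C * ‖j x‖ ^ 2) :=
          mul_le_mul_of_nonneg_left (by linarith) (Real.exp_pos _).le)
  have h1 : ∫ s, Real.exp (2 * C * s) * ‖x₀ + primitive (timeMeasure T) f s‖ ^ 2
      ∂(timeMeasure T) ≤ 0 := by
    rw [integral_const_mul] at hle
    by_contra hn
    have h2 := mul_pos (mul_pos two_pos hα) (not_le.1 hn)
    have h3 := sq_nonneg ‖j x₀‖
    linarith
  filter_upwards [hF, ae_eq_zero_of_integral_exp_mul_nonpos hc _ h1] with s hs hs0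
  rw [hs0, map_zero] at hs
  have h3 : inner ℝ (j (f s)) (j (f s)) = 0 := by
    rw [← inner_adjoint_comp_self, hs, inner_zero_left]
  exact hj (by rw [inner_self_eq_zero.1 h3, map_zero])

end Parabolic

/-! ### Regular paths: a priori bound and density of their forcings. -/

section RegularSolutions

/-- Paths are bounded continuous functions on all of `ℝ`; this reduces their sup norm to times in
`[0,T]`, where the energy estimate holds. -/
theorem primitive_clamp {X : Type*} [NormedAddCommGroup X] [NormedSpace ℝ X] {T : ℝ} (f : ℝ → X)
    (t : ℝ) : primitive (timeMeasure T) f t = primitive (timeMeasure T) f (max 0 (min t T)) := by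
  have h : Set.Iic t ∩ Set.Ioo 0 T = Set.Iic (max 0 (min t T)) ∩ Set.Ioo 0 T := by
    ext s
    simp only [Set.mem_inter_iff, Set.mem_Iic, Set.mem_Ioo, le_max_iff, le_min_iff]
    refine ⟨fun ⟨h1, h2⟩ => ⟨Or.inr ⟨h1, h2.2.le⟩, h2⟩, fun ⟨h1, h2⟩ => ⟨?_, h2⟩⟩
    exact (h1.resolve_left (not_le.2 h2.1)).1
  rw [primitive, primitive, Measure.restrict_restrict measurableSet_Iic,
    Measure.restrict_restrict measurableSet_Iic, h]

/-- A linear map dominated by another one extends to the closure of the range of the latter. -/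
theorem exists_mem_closure_range_prod {X E Y : Type*} [AddCommGroup X] [Module ℝ X]
    [NormedAddCommGroup E] [NormedSpace ℝ E] [CompleteSpace E]
    [NormedAddCommGroup Y] [NormedSpace ℝ Y] (S : X →ₗ[ℝ] E) (R : X →ₗ[ℝ] Y) {c : ℝ}
    (hc : ∀ x, ‖S x‖ ≤ c * ‖R x‖) {y : Y} (hy : y ∈ closure (Set.range R)) :
    ∃ e : E, (e, y) ∈ closure (Set.range fun x => (S x, R x)) := by
  obtain ⟨s, hs, hlim⟩ := mem_closure_iff_seq_limit.1 hy
  choose x hx using hs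
  have hlim' : Filter.Tendsto (fun n => R (x n)) Filter.atTop (nhds y) := by simpa only [hx]
  have hcauchy : CauchySeq fun n => S (x n) := by
    have h1 := hlim'.cauchySeq
    rw [Metric.cauchySeq_iff] at h1 ⊢
    intro ε hε
    obtain ⟨N, hN⟩ := h1 (ε / (|c| + 1)) (by positivity)
    refine ⟨N, fun m hm n hn => ?_⟩
    have h2 := hN m hm n hn
    rw [dist_eq_norm, ← map_sub, lt_div_iff₀ (by positivity)] at h2
    rw [dist_eq_norm, ← map_sub]
    calc ‖S (x m - x n)‖ ≤ c * ‖R (x m - x n)‖ := hc _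
      _ ≤ ‖R (x m - x n)‖ * (|c| + 1) := by
        rw [mul_comm]
        exact mul_le_mul_of_nonneg_left ((le_abs_self c).trans (by linarith)) (norm_nonneg _)
      _ < ε := h2
  obtain ⟨e, he⟩ := cauchySeq_tendsto_of_complete hcauchy
  exact ⟨e, mem_closure_of_tendsto (he.prodMk_nhds hlim')
    (Filter.Eventually.of_forall fun n => ⟨x n, rfl⟩)⟩

variable {T : ℝ} {V H : Type*} [NormedAddCommGroup V] [InnerProductSpace ℝ V]
  [NormedAddCommGroup H] [InnerProductSpace ℝ H]

/-- The path `t ↦ x₀ + ∫₀ᵗ u`. -/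
def regularPath (T : ℝ) (V : Type*) [NormedAddCommGroup V] [InnerProductSpace ℝ V] :
    V × L2 T V →ₗ[ℝ] BoundedContinuousFunction ℝ V where
  toFun z := BoundedContinuousFunction.ofNormedAddCommGroup
    (fun t => z.1 + primitive (timeMeasure T) z.2 t)
    (continuous_add_primitive (integrable_L2 z.2) z.1) _
    (norm_add_primitive_le (integrable_L2 z.2) z.1)
  map_add' z w := by
    ext t
    have h : primitive (timeMeasure T) (z.2 + w.2 : L2 T V) t
        = primitive (timeMeasure T) z.2 t + primitive (timeMeasure T) w.2 t := by
      rw [← primitive_add (integrable_L2 z.2) (integrable_L2 w.2)]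
      exact primitive_congr (Lp.coeFn_add z.2 w.2) t
    change z.1 + w.1 + primitive (timeMeasure T) (z.2 + w.2 : L2 T V) t = z.1 + _ + (w.1 + _)
    rw [h]
    abel
  map_smul' r z := by
    ext t
    have h : primitive (timeMeasure T) (r • z.2 : L2 T V) t
        = r • primitive (timeMeasure T) z.2 t := by
      rw [primitive_congr (Lp.coeFn_smul r z.2) t]
      exact integral_smul r _
    change r • z.1 + primitive (timeMeasure T) (r • z.2 : L2 T V) t = r • (z.1 + _)
    rw [h, smul_add]

/-- The regular path as an element of `L²(0,T;V)`. -/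
def regularL2 (T : ℝ) (V : Type*) [NormedAddCommGroup V] [InnerProductSpace ℝ V] :
    V × L2 T V →ₗ[ℝ] L2 T V :=
  (BoundedContinuousFunction.toLp 2 (timeMeasure T) ℝ).toLinearMap ∘ₗ regularPath T V

theorem coeFn_regularL2 (z : V × L2 T V) :
    regularL2 T V z =ᵐ[timeMeasure T] fun t => z.1 + primitive (timeMeasure T) z.2 t :=
  BoundedContinuousFunction.coeFn_toLp (p := 2) (μ := timeMeasure T) (𝕜 := ℝ) (regularPath T V z)

variable [CompleteSpace V] [CompleteSpace H]

/-- The forcing `j* j x' + a x` of a regular path `x`. -/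
def regularForcing (T : ℝ) (j : V →L[ℝ] H) (a : V →L[ℝ] V) : V × L2 T V →ₗ[ℝ] L2 T V :=
  ((j.adjoint ∘L j).compLpL 2 (timeMeasure T)).toLinearMap ∘ₗ LinearMap.snd ℝ V (L2 T V)
    + (a.compLpL 2 (timeMeasure T)).toLinearMap ∘ₗ regularL2 T V

theorem regularForcing_apply (j : V →L[ℝ] H) (a : V →L[ℝ] V) (z : V × L2 T V) :
    regularForcing T j a z = (j.adjoint ∘L j).compLp z.2 + a.compLp (regularL2 T V z) := rfl

theorem coeFn_regularForcing (j : V →L[ℝ] H) (a : V →L[ℝ] V) (z : V × L2 T V) :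
    ∀ᵐ t ∂(timeMeasure T), (j.adjoint ∘L j) (z.2 t)
      + a (z.1 + primitive (timeMeasure T) z.2 t) = regularForcing T j a z t := by
  rw [regularForcing_apply]
  filter_upwards [Lp.coeFn_add ((j.adjoint ∘L j).compLp z.2) (a.compLp (regularL2 T V z)),
    (j.adjoint ∘L j).coeFn_compLp z.2, a.coeFn_compLp (regularL2 T V z), coeFn_regularL2 z]
    with t h1 h2 h3 h4
  rw [h1, Pi.add_apply, h2, h3, h4]

theorem regular_lineDeriv (hT : 0 < T) (j : V →L[ℝ] H) (a : V →L[ℝ] V) (z : V × L2 T V) :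
    ∂_{(1 : ℝ)} (toDistribution ((j.adjoint ∘L j).compLp (regularL2 T V z)))
      + toDistribution (a.compLp (regularL2 T V z)) = toDistribution (regularForcing T j a z) := by
  rw [← mapCLM_toDistribution, lineDeriv_mapCLM,
    lineDeriv_toDistribution_primitive hT (coeFn_regularL2 z), mapCLM_toDistribution,
    regularForcing_apply, toDistribution_add]

/-- The energy estimate at `t = T` controls the `L²(0,T;V)` norm, and at arbitrary `t` the sup norm
in `H`. The exponential weight is bounded below on `[0,T]`. -/
theorem exists_regular_bound (hT : 0 < T) (j : V →L[ℝ] H) (a : V →L[ℝ] V) {α C : ℝ}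
    (hα : 0 < α) (hC : 0 ≤ C) (ha : ∀ v, α * ‖v‖ ^ 2 ≤ inner ℝ (a v) v + C * ‖j v‖ ^ 2) :
    ∃ c : ℝ, ∀ z : V × L2 T V,
      ‖(regularL2 T V z, j.compLeftContinuousBounded ℝ (regularPath T V z))‖
        ≤ c * ‖(regularForcing T j a z, j z.1)‖ := by
  set e := Real.exp (-2 * C * T) with he
  have he0 : 0 < e := Real.exp_pos _
  have hexp : ∀ s ∈ Set.Icc 0 T, e ≤ Real.exp (-2 * C * s) := fun s hs => by
    rw [he, Real.exp_le_exp]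
    have := mul_le_mul_of_nonneg_left hs.2 hC
    linarith
  -- The sum dominates the constants of both estimates.
  set k := (1 + α⁻¹) / e + (1 + α⁻¹) / (α * e) with hk
  have hk1 : (1 + α⁻¹) / e ≤ k := le_add_of_nonneg_right (by positivity)
  have hk2 : (1 + α⁻¹) / (α * e) ≤ k := le_add_of_nonneg_left (by positivity)
  have hk0 : 0 ≤ k := by positivity
  refine ⟨Real.sqrt k, fun z => ?_⟩
  set r := ‖(regularForcing T j a z, j z.1)‖ with hr
  have hr0 : 0 ≤ r := norm_nonneg _
  have hrhs : ‖j z.1‖ ^ 2 + α⁻¹ * ‖regularForcing T j a z‖ ^ 2 ≤ (1 + α⁻¹) * r ^ 2 := by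
    have h1 : ‖j z.1‖ ≤ r := norm_snd_le (regularForcing T j a z, j z.1)
    have h2 : ‖regularForcing T j a z‖ ≤ r := norm_fst_le (regularForcing T j a z, j z.1)
    calc ‖j z.1‖ ^ 2 + α⁻¹ * ‖regularForcing T j a z‖ ^ 2 ≤ r ^ 2 + α⁻¹ * r ^ 2 := by gcongr
      _ = (1 + α⁻¹) * r ^ 2 := by ring
  have hest := fun t (ht : t ∈ Set.Icc 0 T) =>
    (energy_estimate j a hα hC ha (integrable_L2 z.2) z.1 (regularForcing T j a z)
      (coeFn_regularForcing j a z) ht).trans hrhs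
  have hnn : ∀ t, 0 ≤ primitive (timeMeasure T) (fun s => Real.exp (-2 * C * s) *
      ‖z.1 + primitive (timeMeasure T) z.2 s‖ ^ 2) t := fun t =>
    integral_nonneg fun s => by positivity
  have hsq : ∀ {m : ℝ}, m ^ 2 ≤ k * r ^ 2 → m ≤ Real.sqrt k * r := fun {m} hm => by
    refine le_of_sq_le_sq ?_ (by positivity)
    rwa [mul_pow, Real.sq_sqrt hk0]
  refine max_le (hsq ?_) ?_
  · have h1 : ‖regularL2 T V z‖ ^ 2
        = ∫ s, ‖z.1 + primitive (timeMeasure T) z.2 s‖ ^ 2 ∂(timeMeasure T) := by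
      rw [← real_inner_self_eq_norm_sq (regularL2 T V z), L2.inner_def]
      refine integral_congr_ae ?_
      filter_upwards [coeFn_regularL2 z] with s hs
      rw [real_inner_self_eq_norm_sq, hs]
    have hc := continuous_add_primitive (integrable_L2 z.2) z.1
    have h2 : e * ‖regularL2 T V z‖ ^ 2 ≤ primitive (timeMeasure T)
        (fun s => Real.exp (-2 * C * s) * ‖z.1 + primitive (timeMeasure T) z.2 s‖ ^ 2) T := by
      rw [h1, primitive_final, ← integral_const_mul]
      refine integral_mono_ae (integrable_of_continuous (by fun_prop))
        (integrable_of_continuous (by fun_prop)) ?_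
      filter_upwards [ae_restrict_mem measurableSet_Ioo] with s hs
      exact mul_le_mul_of_nonneg_right (hexp s ⟨hs.1.le, hs.2.le⟩) (sq_nonneg _)
    have h3 := hest T ⟨hT.le, le_rfl⟩
    have h4 : 0 ≤ Real.exp (-2 * C * T) * ‖j (z.1 + primitive (timeMeasure T) z.2 T)‖ ^ 2 := by
      positivity
    have h5 := mul_le_mul_of_nonneg_left h2 hα.le
    have h6 : ‖regularL2 T V z‖ ^ 2 * (α * e) ≤ (1 + α⁻¹) * r ^ 2 := by linarith
    calc ‖regularL2 T V z‖ ^ 2 ≤ (1 + α⁻¹) * r ^ 2 / (α * e) :=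
          (le_div_iff₀ (by positivity)).2 h6
      _ = (1 + α⁻¹) / (α * e) * r ^ 2 := by ring
      _ ≤ k * r ^ 2 := by gcongr
  · refine (BoundedContinuousFunction.norm_le (by positivity)).2 fun t => hsq ?_
    change ‖j (z.1 + primitive (timeMeasure T) z.2 t)‖ ^ 2 ≤ _
    rw [primitive_clamp]
    have ht : max 0 (min t T) ∈ Set.Icc 0 T :=
      ⟨le_max_left _ _, max_le hT.le (min_le_right _ _)⟩
    set τ := max 0 (min t T)
    have h3 := hest τ ht
    have h4 := mul_nonneg hα.le (hnn τ)
    have h5 := mul_le_mul_of_nonneg_right (hexp τ ht)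
      (sq_nonneg ‖j (z.1 + primitive (timeMeasure T) z.2 τ)‖)
    have h6 : ‖j (z.1 + primitive (timeMeasure T) z.2 τ)‖ ^ 2 * e ≤ (1 + α⁻¹) * r ^ 2 := by
      linarith
    calc ‖j (z.1 + primitive (timeMeasure T) z.2 τ)‖ ^ 2 ≤ (1 + α⁻¹) * r ^ 2 / e :=
          (le_div_iff₀ (by positivity)).2 h6
      _ = (1 + α⁻¹) / e * r ^ 2 := by ring
      _ ≤ k * r ^ 2 := by gcongr

/-- If `w` is orthogonal to the forcings of all regular paths starting at `0`, then `W(t) = ∫ₜᵀ w`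
satisfies `j* j w + a* W = 0`, the homogeneous backward adjoint problem, so `w = 0`. -/
theorem closure_range_regularForcing_zero (hT : 0 < T) (j : V →L[ℝ] H)
    (hj : Function.Injective j) (a : V →L[ℝ] V) {α C : ℝ} (hα : 0 < α)
    (ha : ∀ v, α * ‖v‖ ^ 2 ≤ inner ℝ (a v) v + C * ‖j v‖ ^ 2) :
    (LinearMap.range (regularForcing T j a ∘ₗ LinearMap.inr ℝ V (L2 T V))).topologicalClosure
      = ⊤ := by
  rw [Submodule.topologicalClosure_eq_top_iff, Submodule.eq_bot_iff]
  intro w hw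
  have hwi := integrable_L2 w
  have hnw : Integrable (fun s => -w s) (timeMeasure T) := hwi.neg
  -- With this initial value the path of derivative `-w` ends at `0`, that is, it equals `∫ₜᵀ w`.
  set W₀ : V := ∫ s, w s ∂(timeMeasure T) with hW₀
  have hpn : ∀ t, primitive (timeMeasure T) (-w : L2 T V) t
      = primitive (timeMeasure T) (fun s => -w s) t :=
    fun t => primitive_congr (Lp.coeFn_neg w) t
  set W : L2 T V := regularL2 T V (W₀, -w) with hW
  have hWae : W =ᵐ[timeMeasure T] fun t => W₀ + primitive (timeMeasure T) (fun s => -w s) t := by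
    filter_upwards [coeFn_regularL2 (W₀, -w)] with t ht
    rw [ht, ← hpn]
  have hfin : W₀ + primitive (timeMeasure T) (fun s => -w s) T = 0 := by
    rw [primitive_final, integral_neg, hW₀, add_neg_cancel]
  have hz : (j.adjoint ∘L j).compLp w + a.adjoint.compLp W = 0 := by
    refine ext_inner_left ℝ fun u => ?_
    rw [inner_zero_right]
    have hu := integrable_L2 u
    have horth : inner ℝ (regularForcing T j a (0, u)) w = 0 := hw _ ⟨u, rfl⟩
    let b : V →L[ℝ] V →L[ℝ] ℝ := (innerSL ℝ : V →L[ℝ] V →L[ℝ] ℝ) ∘L a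
    have hb : ∀ x y, b x y = inner ℝ (a x) y := fun _ _ => rfl
    -- Integration by parts in time moves the primitive from `u` to `w`. Both boundary terms vanish,
    -- since `∫ u` starts at `0` and `W` ends at `0`.
    have key := bilin_primitive b hu hnw 0 W₀ T
    rw [hfin, map_zero, map_zero, zero_apply, zero_add,
      primitive_final (fun s => b (u s) (W₀ + primitive (timeMeasure T) (fun s => -w s) s)
        + b (0 + primitive (timeMeasure T) u s) (-w s))] at key
    rw [← horth, ← sub_eq_zero, L2.inner_def, L2.inner_def,
      ← integral_sub (L2.integrable_inner _ _) (L2.integrable_inner _ _), key]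
    refine integral_congr_ae ?_
    filter_upwards [Lp.coeFn_add ((j.adjoint ∘L j).compLp w) (a.adjoint.compLp W),
      (j.adjoint ∘L j).coeFn_compLp w, a.adjoint.coeFn_compLp W, hWae,
      coeFn_regularForcing j a (0, u)] with s h1 h2 h3 h4 h5
    rw [h1, Pi.add_apply, h2, h3, h4, ← h5, hb, hb, inner_add_right, inner_add_left,
      ContinuousLinearMap.adjoint_inner_right, inner_neg_right, inner_adjoint_comp_self,
      real_inner_comm, inner_adjoint_comp_self, real_inner_comm (j (w s))]
    ring
  have hF : ∀ᵐ s ∂(timeMeasure T), (j.adjoint ∘L j) (-w s)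
      = a.adjoint (W₀ + primitive (timeMeasure T) (fun s => -w s) s) := by
    have hz' := Lp.coeFn_add ((j.adjoint ∘L j).compLp w) (a.adjoint.compLp W)
    rw [hz] at hz'
    filter_upwards [hz', Lp.coeFn_zero V 2 (timeMeasure T), (j.adjoint ∘L j).coeFn_compLp w,
      a.adjoint.coeFn_compLp W, hWae] with s h1 h2 h3 h4 h5
    rw [h2, Pi.add_apply, Pi.zero_apply, h3, h4, h5] at h1
    rw [map_neg]
    exact neg_eq_of_add_eq_zero_right h1.symm
  have := eq_zero_of_backward_homogeneous hT j hj a hα ha hnw hfin hF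
  refine (Lp.eq_zero_iff_ae_eq_zero).2 ?_
  filter_upwards [this] with s hs
  exact neg_eq_zero.1 hs

end RegularSolutions

/-- Tested against a fixed `φ`, the equation equates two continuous functions of the pair; the set
is the intersection over all `φ`. -/
theorem isClosed_setOf_evolution_equation {T : ℝ} {V : Type*} [NormedAddCommGroup V]
    [NormedSpace ℝ V] (G a : V →L[ℝ] V) :
    IsClosed {p : L2 T V × L2 T V | ∂_{(1 : ℝ)} (toDistribution (G.compLp p.1))
      + toDistribution (a.compLp p.1) = toDistribution p.2} := by
  have h : {p : L2 T V × L2 T V | ∂_{(1 : ℝ)} (toDistribution (G.compLp p.1))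
      + toDistribution (a.compLp p.1) = toDistribution p.2}
      = ⋂ φ : 𝓓(timeInterval T, ℝ), {p : L2 T V × L2 T V |
        toDistribution (G.compLp p.1) (-∂_{(1 : ℝ)} φ) + toDistribution (a.compLp p.1) φ
          = toDistribution p.2 φ} := by
    ext p
    simp only [Set.mem_ofPred_eq, Set.mem_iInter, ← Distribution.lineDerivOp_apply_apply]
    exact ⟨fun h φ => congrArg (fun D : 𝓓'(timeInterval T, V) => D φ) h,
      fun h => ContinuousLinearMap.ext h⟩
  rw [h]
  refine isClosed_iInter fun φ => isClosed_eq (.add ?_ ?_) ?_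
  · exact (continuous_toDistribution_apply _).comp
      ((G.compLpL 2 (timeMeasure T)).continuous.comp continuous_fst)
  · exact (continuous_toDistribution_apply _).comp
      ((a.compLpL 2 (timeMeasure T)).continuous.comp continuous_fst)
  · exact (continuous_toDistribution_apply _).comp continuous_snd

/-! ### Weak solvability and uniqueness of the parabolic problem. -/

section ParabolicProblem

variable {T : ℝ} {V H : Type*} [NormedAddCommGroup V] [InnerProductSpace ℝ V] [CompleteSpace V]
  [NormedAddCommGroup H] [InnerProductSpace ℝ H] [CompleteSpace H]

/-- The data `(F, x)` are limits of data of regular paths, and the a priori bound makes these paths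
converge in `L²(0,T;V)` and uniformly in `H`. The evolution equation, the agreement of the two
limits and the initial condition are closed relations that hold for regular paths. -/
theorem exists_parabolic_solution (hT : 0 < T) (j : V →L[ℝ] H) (hj : Function.Injective j)
    (a : V →L[ℝ] V) {α C : ℝ} (hα : 0 < α) (hC : 0 ≤ C)
    (ha : ∀ v, α * ‖v‖ ^ 2 ≤ inner ℝ (a v) v + C * ‖j v‖ ^ 2) (F : L2 T V) {x : H}
    (hx : x ∈ closure (Set.range j)) :
    ∃ u : L2 T V, ∂_{(1 : ℝ)} (toDistribution ((j.adjoint ∘L j).compLp u))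
        + toDistribution (a.compLp u) = toDistribution F ∧
      IsContinuousWithInitialValue T (fun t => j (u t)) x := by
  let R : V × L2 T V →ₗ[ℝ] L2 T V × H :=
    (regularForcing T j a).prod (j.toLinearMap ∘ₗ LinearMap.fst ℝ V (L2 T V))
  let S : V × L2 T V →ₗ[ℝ] L2 T V × BoundedContinuousFunction ℝ H :=
    (regularL2 T V).prod ((j.compLeftContinuousBounded ℝ).toLinearMap ∘ₗ regularPath T V)
  obtain ⟨c, hc⟩ := exists_regular_bound hT j a hα hC ha
  have hzero : ∀ F' : L2 T V, (F', (0 : H)) ∈ (LinearMap.range R).topologicalClosure := fun F' => by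
    have hF' : F' ∈ closure (Set.range fun u : L2 T V => regularForcing T j a (0, u)) := by
      have := closure_range_regularForcing_zero hT j hj a hα ha
      exact (this ▸ Submodule.mem_top : F' ∈ (LinearMap.range
        (regularForcing T j a ∘ₗ LinearMap.inr ℝ V (L2 T V))).topologicalClosure)
    refine map_mem_closure (f := fun G : L2 T V => (G, (0 : H))) (by fun_prop) hF' ?_
    rintro _ ⟨u, rfl⟩
    exact ⟨(0, u), Prod.ext rfl (map_zero j)⟩
  have hdense : (F, x) ∈ closure (Set.range R) := by
    have hcl : IsClosed {y : H | (F, y) ∈ (LinearMap.range R).topologicalClosure} :=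
      (Submodule.isClosed_topologicalClosure _).preimage (by fun_prop)
    refine closure_minimal ?_ hcl hx
    rintro _ ⟨v, rfl⟩
    have h1 : R (v, 0) ∈ (LinearMap.range R).topologicalClosure :=
      Submodule.le_topologicalClosure _ ⟨_, rfl⟩
    -- The constant path `v` supplies the initial value `j v`; the defect of its forcing is
    -- corrected by paths starting at `0`.
    have h2 := Submodule.add_mem _ (hzero (F - regularForcing T j a (v, 0))) h1
    have h3 : (F - regularForcing T j a (v, 0), (0 : H)) + R (v, 0) = (F, j v) :=
      Prod.ext (sub_add_cancel _ _) (zero_add _)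
    rwa [h3] at h2
  obtain ⟨⟨u, v⟩, huv⟩ := exists_mem_closure_range_prod S R hc hdense
  refine ⟨u, ?_, v, v.continuous.continuousOn, ?_, ?_⟩
  · have hcl := (isClosed_setOf_evolution_equation (T := T) (j.adjoint ∘L j) a).preimage
      (by fun_prop : Continuous fun p : (L2 T V × BoundedContinuousFunction ℝ H) × (L2 T V × H) =>
        (p.1.1, p.2.1))
    have h := closure_minimal ?_ hcl huv
    · exact h
    · rintro _ ⟨z, rfl⟩
      exact regular_lineDeriv hT j a z
  · have hcl : IsClosed {p : (L2 T V × BoundedContinuousFunction ℝ H) × (L2 T V × H) |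
        j.compLpL 2 (timeMeasure T) p.1.1
          = BoundedContinuousFunction.toLp 2 (timeMeasure T) ℝ p.1.2} :=
      isClosed_eq (by fun_prop) (by fun_prop)
    have h := closure_minimal ?_ hcl huv
    · have h' : j.compLp u = BoundedContinuousFunction.toLp 2 (timeMeasure T) ℝ v := h
      filter_upwards [j.coeFn_compLp u, BoundedContinuousFunction.coeFn_toLp (p := 2)
        (μ := timeMeasure T) (𝕜 := ℝ) v] with t h1 h2
      rw [← h1, h', h2]
    · rintro _ ⟨z, rfl⟩
      refine Lp.ext ?_
      filter_upwards [j.coeFn_compLp (regularL2 T V z), coeFn_regularL2 z,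
        BoundedContinuousFunction.coeFn_toLp (p := 2) (μ := timeMeasure T) (𝕜 := ℝ)
          (j.compLeftContinuousBounded ℝ (regularPath T V z))] with t h1 h2 h3
      refine h1.trans (Eq.trans ?_ h3.symm)
      rw [h2]
      rfl
  · have hcl : IsClosed {p : (L2 T V × BoundedContinuousFunction ℝ H) × (L2 T V × H) |
        p.1.2 0 = p.2.2} := isClosed_eq (by fun_prop) (by fun_prop)
    refine closure_minimal ?_ hcl huv
    rintro _ ⟨z, rfl⟩
    change j (z.1 + primitive (timeMeasure T) z.2 0) = j z.1
    rw [primitive_initial, add_zero]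

/-- Integrating the equation in time gives `j* j u + a (∫ u) = 0`. So `∫ u` is a regular path from
`0` solving the homogeneous equation, and its derivative `u` vanishes. -/
theorem parabolic_solution_eq_zero (hT : 0 < T) (j : V →L[ℝ] H) (hj : Function.Injective j)
    (a : V →L[ℝ] V) {α C : ℝ} (hα : 0 < α) (hC : 0 ≤ C)
    (ha : ∀ v, α * ‖v‖ ^ 2 ≤ inner ℝ (a v) v + C * ‖j v‖ ^ 2) {u : L2 T V}
    (hu : ∂_{(1 : ℝ)} (toDistribution ((j.adjoint ∘L j).compLp u))
        + toDistribution (a.compLp u) = 0)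
    (h0 : IsContinuousWithInitialValue T (fun t => j (u t)) 0) : u = 0 := by
  have hau := integrable_L2 (a.compLp u)
  have hder : ∂_{(1 : ℝ)} (toDistribution ((j.adjoint ∘L j).compLp u
      + regularL2 T V (0, a.compLp u))) = 0 := by
    rw [toDistribution_add, LineDeriv.lineDerivOp_add,
      lineDeriv_toDistribution_primitive hT (coeFn_regularL2 (0, a.compLp u)), hu]
  obtain ⟨c, hc⟩ := ae_eq_const_of_lineDeriv_eq_zero hT hder
  obtain ⟨v, hv, huv, hv0⟩ := h0
  have hae : ∀ᵐ t ∂(timeMeasure T), (j.adjoint ∘L j) (u t)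
      + primitive (timeMeasure T) (a.compLp u) t = c := by
    filter_upwards [hc, Lp.coeFn_add ((j.adjoint ∘L j).compLp u) (regularL2 T V (0, a.compLp u)),
      (j.adjoint ∘L j).coeFn_compLp u, coeFn_regularL2 (0, a.compLp u)] with t h1 h2 h3 h4
    rw [← h1, h2, Pi.add_apply, h3, h4, zero_add]
  -- Continuity upgrades the almost everywhere identity to all of `[0,T]`, so that the constant can
  -- be read off at time `0`.
  have hEq : Set.EqOn (fun t => j.adjoint (v t) + primitive (timeMeasure T) (a.compLp u) t)
      (fun _ => c) (Set.Icc 0 T) := by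
    refine Measure.eqOn_Icc_of_ae_eq volume hT.ne ?_
      ((j.adjoint.continuous.comp_continuousOn hv).add (continuous_primitive hau).continuousOn)
      continuousOn_const
    rw [← restrict_Ioo_eq_restrict_Icc]
    filter_upwards [hae, huv] with t h1 h2
    rw [← h1, ← h2]
    rfl
  have hc0 : c = 0 := by
    have := hEq ⟨le_rfl, hT.le⟩
    simpa only [hv0, map_zero, primitive_initial, add_zero] using this.symm
  refine (Lp.eq_zero_iff_ae_eq_zero).2
    (eq_zero_of_homogeneous hT j hj a hα hC ha (integrable_L2 u) ?_)
  filter_upwards [hae] with t ht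
  rw [← hc0, ← ht, map_primitive a (integrable_L2 u), primitive_congr (a.coeFn_compLp u)]

end ParabolicProblem

/-! ### Inverses of `D` and `B`, reduction to `ker B`, Gårding's inequality. -/

section Operators

variable {P H M Q : Type*}
  [NormedAddCommGroup P] [InnerProductSpace ℝ P]
  [NormedAddCommGroup H] [InnerProductSpace ℝ H]
  [NormedAddCommGroup M] [InnerProductSpace ℝ M]
  [NormedAddCommGroup Q] [InnerProductSpace ℝ Q]

/-- The inverse of the Riesz isomorphism. -/
def rieszRep (P : Type*) [NormedAddCommGroup P] [InnerProductSpace ℝ P] [CompleteSpace P] :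
    StrongDual ℝ P →L[ℝ] P where
  toFun := (InnerProductSpace.toDual ℝ P).symm
  map_add' := map_add _
  map_smul' r ξ := by simp
  cont := (InnerProductSpace.toDual ℝ P).symm.continuous

theorem inner_rieszRep [CompleteSpace P] (ξ : StrongDual ℝ P) (q : P) : inner ℝ (rieszRep P ξ) q
    = ξ q :=
  InnerProductSpace.toDual_symm_apply (𝕜 := ℝ)

/-- Lax–Milgram: an elliptic operator has a bounded inverse. -/
theorem IsElliptic.exists_inverse [CompleteSpace M] {D : M →L[ℝ] StrongDual ℝ M}
    (hD : IsElliptic D) :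
    ∃ E : StrongDual ℝ M →L[ℝ] M, (∀ ξ, D (E ξ) = ξ) ∧ ∀ m, E (D m) = m := by
  obtain ⟨c, hc, h⟩ := hD
  have hco : IsCoercive D := ⟨c, hc, fun m => by
    have := h m
    rwa [pow_two, ← mul_assoc] at this⟩
  have he := hco.continuousLinearEquivOfBilin_apply
  set e := hco.continuousLinearEquivOfBilin
  refine ⟨(e.symm : M →L[ℝ] M) ∘L rieszRep M, fun ξ => ?_, fun m => ?_⟩
  · ext w
    rw [← he, ContinuousLinearMap.comp_apply, ContinuousLinearEquiv.coe_coe, e.apply_symm_apply,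
      inner_rieszRep]
  · rw [ContinuousLinearMap.comp_apply, ContinuousLinearEquiv.coe_coe, e.symm_apply_eq]
    refine ext_inner_right ℝ fun w => ?_
    rw [inner_rieszRep, he]

theorem IsInfSupStable.exists_lower_bound [CompleteSpace P] [CompleteSpace Q]
    {B : P →L[ℝ] StrongDual ℝ Q} (hB : IsInfSupStable B) :
    ∃ β : ℝ, 0 < β ∧ ∀ μ, β * ‖μ‖ ≤ ‖(rieszRep Q ∘L B).adjoint μ‖ := by
  obtain ⟨β, hβ, h⟩ := hB
  refine ⟨β, hβ, fun μ => ?_⟩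
  rcases eq_or_ne μ 0 with rfl | hμ
  · simp
  have hμ' : 0 < ‖μ‖ := norm_pos_iff.2 hμ
  rw [← le_div_iff₀ hμ']
  -- The bound must be nonnegative because a real supremum over the empty set, the case of trivial
  -- `P`, is `0`.
  refine (h μ hμ).trans (Real.iSup_le (fun q => ?_) (by positivity))
  have hq : 0 < ‖(q : P)‖ := norm_pos_iff.2 q.2
  have h1 : B q μ = inner ℝ (q : P) ((rieszRep Q ∘L B).adjoint μ) := by
    rw [ContinuousLinearMap.adjoint_inner_right, ContinuousLinearMap.comp_apply, inner_rieszRep]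
  rw [h1, div_le_div_iff₀ (by positivity) hμ']
  have h2 := mul_le_mul_of_nonneg_right
    (real_inner_le_norm (q : P) ((rieszRep Q ∘L B).adjoint μ)) hμ'.le
  linarith

/-- An inf-sup stable operator has a bounded right inverse with values in `(ker B)ᗮ`. -/
theorem IsInfSupStable.exists_rightInverse [CompleteSpace P] [CompleteSpace Q]
    {B : P →L[ℝ] StrongDual ℝ Q} (hB : IsInfSupStable B) :
    ∃ S : StrongDual ℝ Q →L[ℝ] P, (∀ x, B (S x) = x) ∧ ∀ x, S x ∈ (kerSpace B)ᗮ := by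
  obtain ⟨β, hβ, h⟩ := hB.exists_lower_bound
  set b : P →L[ℝ] Q := rieszRep Q ∘L B with hb
  have hbB : ∀ q μ, inner ℝ (b q) μ = B q μ := fun q μ => inner_rieszRep _ _
  -- The lower bound for `b*` makes `b b*` coercive, so the right inverse can be taken as `b* (b
  -- b*)⁻¹`; its values lie in the range of `b*`, which is orthogonal to `ker B`.
  let c : Q →L[ℝ] Q →L[ℝ] ℝ := (innerSL ℝ : Q →L[ℝ] Q →L[ℝ] ℝ) ∘L (b ∘L b.adjoint)
  have hc : ∀ μ ν, c μ ν = inner ℝ (b (b.adjoint μ)) ν := fun _ _ => rfl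
  have hco : IsCoercive c := ⟨β * β, by positivity, fun μ => by
    rw [hc, ← ContinuousLinearMap.adjoint_inner_right, real_inner_self_eq_norm_mul_norm]
    have := mul_self_le_mul_self (by positivity) (h μ)
    linarith⟩
  have he := hco.continuousLinearEquivOfBilin_apply
  set e := hco.continuousLinearEquivOfBilin
  have heq : ∀ μ, e μ = b (b.adjoint μ) := fun μ => ext_inner_right ℝ fun ν => by rw [he, hc]
  refine ⟨b.adjoint ∘L (e.symm : Q →L[ℝ] Q) ∘L rieszRep Q, fun x => ?_, fun x => ?_⟩
  · ext ν
    rw [← hbB]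
    simp only [ContinuousLinearMap.comp_apply, ContinuousLinearEquiv.coe_coe]
    rw [← heq, e.apply_symm_apply, inner_rieszRep]
  · rw [Submodule.mem_orthogonal]
    intro q hq
    have hq0 : B q = 0 := hq
    rw [ContinuousLinearMap.comp_apply, ContinuousLinearMap.adjoint_inner_right, hbB, hq0,
      zero_apply]

/-- `B` is injective on `(ker B)ᗮ`, so the value chosen by `Function.invFun` is forced. -/
theorem rightInverse_eq {B : P →L[ℝ] StrongDual ℝ Q} {S : StrongDual ℝ Q →L[ℝ] P}
    (hS : ∀ x, B (S x) = x) (hS' : ∀ x, S x ∈ (kerSpace B)ᗮ) (x : StrongDual ℝ Q) :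
    rightInverse B x = S x := by
  have hinj : Function.Injective fun q : (kerSpace B)ᗮ => B (q : P) := fun q r hqr => by
    have h1 : (q - r : (kerSpace B)ᗮ) = 0 := by
      have h2 : ((q - r : (kerSpace B)ᗮ) : P) ∈ kerSpace B := by
        change B ((q : P) - r) = 0
        rw [map_sub]
        exact sub_eq_zero.2 hqr
      have h3 := (Submodule.mem_orthogonal _ _).1 (q - r).2 _ h2
      exact Subtype.ext (inner_self_eq_zero.1 h3)
    exact sub_eq_zero.1 h1
  have h4 := Function.leftInverse_invFun hinj ⟨S x, hS' x⟩
  simp only [hS] at h4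
  rw [rightInverse, h4]

/-- The dual of a right inverse of `B` is a left inverse of `B*`, and inverts `B*` on the
annihilator of `ker B`. -/
theorem exists_leftInverse_flip [CompleteSpace Q] {B : P →L[ℝ] StrongDual ℝ Q}
    {S : StrongDual ℝ Q →L[ℝ] P}
    (hS : ∀ x, B (S x) = x) :
    ∃ R : StrongDual ℝ P →L[ℝ] Q, (∀ μ, R (B.flip μ) = μ) ∧
      ∀ ξ : StrongDual ℝ P, (∀ q ∈ kerSpace B, ξ q = 0) → B.flip (R ξ) = ξ := by
  let i : Q →L[ℝ] StrongDual ℝ Q := innerSL ℝ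
  have hi : ∀ μ ν, i μ ν = inner ℝ μ ν := fun _ _ => rfl
  let R : StrongDual ℝ P →L[ℝ] Q := rieszRep Q ∘L (ContinuousLinearMap.compL ℝ Q P ℝ).flip (S ∘L i)
  have hR : ∀ ξ ν, inner ℝ (R ξ) ν = ξ (S (i ν)) := fun ξ ν => inner_rieszRep _ _
  refine ⟨R, fun μ => ext_inner_right ℝ fun ν => ?_, fun ξ hξ => ?_⟩
  · rw [hR, ContinuousLinearMap.flip_apply, hS, hi, real_inner_comm]
  · ext q
    have h1 : i (rieszRep Q (B q)) = B q := by
      ext ν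
      rw [hi, inner_rieszRep]
    -- Hence a functional annihilating `ker B` is determined by its values on the range of `S`.
    have h2 : q - S (B q) ∈ kerSpace B := by
      change B (q - S (B q)) = 0
      rw [map_sub, hS, sub_self]
    have h3 := hξ _ h2
    rw [map_sub, sub_eq_zero] at h3
    rw [ContinuousLinearMap.flip_apply, ← inner_rieszRep, real_inner_comm, hR, h1, h3]

instance [CompleteSpace P] (B : P →L[ℝ] StrongDual ℝ Q) : CompleteSpace (kerSpace B) :=
  IsClosed.completeSpace_coe (hs := B.isClosed_ker)

/-- The Riesz representative in `ker B` of the restriction of a functional to `ker B`. -/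
def kerRep [CompleteSpace P] (B : P →L[ℝ] StrongDual ℝ Q) : StrongDual ℝ P →L[ℝ] kerSpace B :=
  rieszRep (kerSpace B) ∘L
    (ContinuousLinearMap.compL ℝ (kerSpace B) P ℝ).flip (kerSpace B).subtypeL

theorem inner_kerRep [CompleteSpace P] (B : P →L[ℝ] StrongDual ℝ Q) (ξ : StrongDual ℝ P)
    (v : kerSpace B) :
    inner ℝ (kerRep B ξ) v = ξ v := inner_rieszRep _ _

/-- This is how the multiplier leaves the equation: `B* μ` vanishes on `ker B`. -/
theorem kerRep_flip [CompleteSpace P] (B : P →L[ℝ] StrongDual ℝ Q) (μ : Q) : kerRep B (B.flip μ)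
    = 0 := by
  refine ext_inner_right ℝ fun v => ?_
  have hv : B v = 0 := v.2
  rw [inner_kerRep, ContinuousLinearMap.flip_apply, hv, zero_apply, inner_zero_left]

theorem apply_eq_zero_of_kerRep_eq_zero [CompleteSpace P] {B : P →L[ℝ] StrongDual ℝ Q}
    {ξ : StrongDual ℝ P}
    (h : kerRep B ξ = 0) (q : P) (hq : q ∈ kerSpace B) : ξ q = 0 := by
  rw [← inner_kerRep B ξ ⟨q, hq⟩, h, inner_zero_left]

/-- The operator `A + K* D⁻¹ K`, obtained by eliminating the flux variable. -/
def eliminatedOperator (ι : P →L[ℝ] H) (A : H →L[ℝ] StrongDual ℝ H) (K : P →L[ℝ] StrongDual ℝ M)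
    (E : StrongDual ℝ M →L[ℝ] M) : P →L[ℝ] StrongDual ℝ P :=
  restrictedOperator ι A + K.flip ∘L E ∘L K

/-- The eliminated operator on `ker B`. -/
def kerOperator [CompleteSpace P] (ι : P →L[ℝ] H) (A : H →L[ℝ] StrongDual ℝ H)
    (K : P →L[ℝ] StrongDual ℝ M)
    (E : StrongDual ℝ M →L[ℝ] M) (B : P →L[ℝ] StrongDual ℝ Q) : kerSpace B →L[ℝ] kerSpace B :=
  kerRep B ∘L eliminatedOperator ι A K E ∘L (kerSpace B).subtypeL

theorem kerRep_gelfandEmbedding [CompleteSpace P] [CompleteSpace H] (ι : P →L[ℝ] H)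
    (B : P →L[ℝ] StrongDual ℝ Q) (v : kerSpace B) :
    kerRep B (gelfandEmbedding ι v)
      = ((ι ∘L (kerSpace B).subtypeL).adjoint ∘L (ι ∘L (kerSpace B).subtypeL)) v := by
  refine ext_inner_right ℝ fun w => ?_
  rw [inner_kerRep, inner_adjoint_comp_self]
  rfl

/-- Gårding's inequality for the eliminated operator on `ker B`. -/
theorem kerOperator_garding [CompleteSpace P] (ι : P →L[ℝ] H) (A : H →L[ℝ] StrongDual ℝ H)
    {K : P →L[ℝ] StrongDual ℝ M} {D : M →L[ℝ] StrongDual ℝ M} {B : P →L[ℝ] StrongDual ℝ Q}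
    {E : StrongDual ℝ M →L[ℝ] M} (hD : IsElliptic D) (hE : ∀ ξ, D (E ξ) = ξ)
    (hK : ∃ c : ℝ, 0 < c ∧ ∀ q ∈ kerSpace B, c * ‖q‖ ≤ ‖K q‖) :
    ∃ α C : ℝ, 0 < α ∧ 0 ≤ C ∧ ∀ v : kerSpace B,
      α * ‖v‖ ^ 2 ≤ inner ℝ (kerOperator ι A K E B v) v
        + C * ‖(ι ∘L (kerSpace B).subtypeL) v‖ ^ 2 := by
  obtain ⟨cD, hcD, hD⟩ := hD
  obtain ⟨cK, hcK, hK⟩ := hK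
  have hd : 0 < ‖D‖ + 1 := by positivity
  -- Ellipticity bounds `⟨K v, D⁻¹ K v⟩` below by `cD ‖D⁻¹ K v‖²`, and `cK ‖v‖ ≤ ‖K v‖ ≤ ‖D‖ ‖D⁻¹ K
  -- v‖`; the `+ 1` avoids dividing by zero. The term from `A` costs at most `‖A‖ ‖ι v‖²`.
  refine ⟨cD * (cK / (‖D‖ + 1)) ^ 2, ‖A‖, by positivity, norm_nonneg A, fun v => ?_⟩
  have h1 : inner ℝ (kerOperator ι A K E B v) v = A (ι v) (ι v) + K v (E (K v)) :=
    inner_kerRep B _ v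
  have h2 : cK / (‖D‖ + 1) * ‖v‖ ≤ ‖E (K v)‖ := by
    rw [div_mul_eq_mul_div, div_le_iff₀ hd]
    calc cK * ‖v‖ ≤ ‖K v‖ := hK v v.2
      _ = ‖D (E (K v))‖ := by rw [hE]
      _ ≤ ‖D‖ * ‖E (K v)‖ := D.le_opNorm _
      _ ≤ ‖E (K v)‖ * (‖D‖ + 1) := by linarith [norm_nonneg (E (K v))]
  have h3 : cD * ‖E (K v)‖ ^ 2 ≤ K v (E (K v)) := by
    have := hD (E (K v))
    rwa [hE] at this
  have h4 : cD * (cK / (‖D‖ + 1)) ^ 2 * ‖v‖ ^ 2 ≤ cD * ‖E (K v)‖ ^ 2 := by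
    rw [mul_assoc, ← mul_pow]
    gcongr
  have h5 : -(‖A‖ * ‖ι v‖ ^ 2) ≤ A (ι v) (ι v) := by
    have := A.le_opNorm₂ (ι v) (ι v)
    rw [Real.norm_eq_abs] at this
    have := (abs_le.1 this).1
    linarith
  have h6 : ‖(ι ∘L (kerSpace B).subtypeL) v‖ = ‖ι v‖ := rfl
  rw [h1, h6]
  linarith

end Operators

/-! ### Back to the constrained system. -/

section WeakSolutions

theorem toDistribution_compLp_apply {T : ℝ} {X Y : Type*} [NormedAddCommGroup X] [NormedSpace ℝ X]
    [CompleteSpace X] [NormedAddCommGroup Y] [NormedSpace ℝ Y] [CompleteSpace Y] (L : X →L[ℝ] Y)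
    (u : L2 T X) (φ : 𝓓(timeInterval T, ℝ)) :
    toDistribution (L.compLp u) φ = L (toDistribution u φ) := by
  rw [← mapCLM_toDistribution, Distribution.mapCLM_apply]

variable {T : ℝ} {P H M Q : Type*}
  [NormedAddCommGroup P] [InnerProductSpace ℝ P] [CompleteSpace P]
  [NormedAddCommGroup H] [InnerProductSpace ℝ H]
  [NormedAddCommGroup M] [InnerProductSpace ℝ M] [CompleteSpace M]
  [NormedAddCommGroup Q] [InnerProductSpace ℝ Q]

theorem IsWeakSolution.exists_derivAddMultiplier_eq {ι : P →L[ℝ] H} {A : H →L[ℝ] StrongDual ℝ H}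
    {K : P →L[ℝ] StrongDual ℝ M} {D : M →L[ℝ] StrongDual ℝ M} {B : P →L[ℝ] StrongDual ℝ Q}
    {f : L2 T (StrongDual ℝ M)} {g : L2 T (StrongDual ℝ P)} {h : L2 T (StrongDual ℝ Q)}
    {pInit : H} {p : L2 T P} {m : L2 T M} {lam : 𝓓'(timeInterval T, Q)}
    (hs : IsWeakSolution ι A K D B f g h pInit p m lam) :
    ∃ w : L2 T (StrongDual ℝ P), derivAddMultiplier ι B p lam = toDistribution w := by
  refine ⟨g - (restrictedOperator ι A).compLp p + K.flip.compLp m, ?_⟩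
  rw [toDistribution_add, toDistribution_sub, ← hs.potential_eq, mapCLM_toDistribution,
    mapCLM_toDistribution]
  abel

variable [CompleteSpace H]

/-- Take `p = u + S h`, where `u` solves the parabolic problem on `ker B` with the contributions of
`f`, `h` and `h'` moved to the right-hand side, and `m = E (f - K p)`. The multiplier is recovered
from the residual. -/
theorem exists_isWeakSolution (hT : 0 < T) (ι : P →L[ℝ] H) (hι : Function.Injective ι)
    (A : H →L[ℝ] StrongDual ℝ H) {K : P →L[ℝ] StrongDual ℝ M} {D : M →L[ℝ] StrongDual ℝ M}
    {B : P →L[ℝ] StrongDual ℝ Q} (hD : IsElliptic D)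
    (hK : ∃ c : ℝ, 0 < c ∧ ∀ q ∈ kerSpace B, c * ‖q‖ ≤ ‖K q‖)
    {E : StrongDual ℝ M →L[ℝ] M} (hE : ∀ ξ, D (E ξ) = ξ)
    {S : StrongDual ℝ Q →L[ℝ] P} (hS : ∀ x, B (S x) = x) {R : StrongDual ℝ P →L[ℝ] Q}
    (hR : ∀ ξ : StrongDual ℝ P, (∀ q ∈ kerSpace B, ξ q = 0) → B.flip (R ξ) = ξ)
    (f : L2 T (StrongDual ℝ M)) (g : L2 T (StrongDual ℝ P)) {h : L2 T (StrongDual ℝ Q)}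
    (hh : MemH1 h) {pInit : H} {h₀ : StrongDual ℝ Q} (hh₀ : IsContinuousWithInitialValue T h h₀)
    (hcons : pInit - ι (S h₀) ∈ kerClosure ι B) :
    ∃ (p : L2 T P) (m : L2 T M) (lam : 𝓓'(timeInterval T, Q)),
      IsWeakSolution ι A K D B f g h pInit p m lam := by
  obtain ⟨h', hh'⟩ := hh
  obtain ⟨α, C, hα, hC, ha⟩ := kerOperator_garding ι A hD hE hK
  set σ : kerSpace B →L[ℝ] P := (kerSpace B).subtypeL with hσ
  have hx : pInit - ι (S h₀) ∈ closure (Set.range (ι ∘L σ)) := by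
    refine closure_mono ?_ hcons
    rintro _ ⟨q, hq, rfl⟩
    exact ⟨⟨q, hq⟩, rfl⟩
  obtain ⟨u, hu, v, hv, huv, hv0⟩ := exists_parabolic_solution hT (ι ∘L σ)
    (hι.comp Subtype.val_injective) (kerOperator ι A K E B) hα hC ha
    ((kerRep B).compLp (g + (K.flip ∘L E).compLp f - (gelfandEmbedding ι ∘L S).compLp h'
      - (eliminatedOperator ι A K E ∘L S).compLp h)) hx
  obtain ⟨hc, hhc, hhae, hhc0⟩ := hh₀
  set p : L2 T P := σ.compLp u + S.compLp h with hp
  have hpae : ∀ᵐ t ∂(timeMeasure T), p t = u t + S (h t) := by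
    filter_upwards [Lp.coeFn_add (σ.compLp u) (S.compLp h), σ.coeFn_compLp u, S.coeFn_compLp h]
      with t h1 h2 h3
    rw [hp, h1, Pi.add_apply, h2, h3]
    rfl
  set m : L2 T M := E.compLp (f - K.compLp p) with hm
  -- The residual of the first equation without multiplier. The equation for `u` says that it
  -- annihilates `ker B`, so it equals `B* (R Ψ)`.
  set Ψ : 𝓓'(timeInterval T, StrongDual ℝ P) :=
    toDistribution (g - (restrictedOperator ι A).compLp p + K.flip.compLp m)
      - ∂_{(1 : ℝ)} (Distribution.mapCLM (gelfandEmbedding ι) (toDistribution p)) with hΨ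
  have hΨ0 : ∀ φ, kerRep B (Ψ φ) = 0 := fun φ => by
    have hpd : ∂_{(1 : ℝ)} (toDistribution p) φ
        = σ (∂_{(1 : ℝ)} (toDistribution u) φ) + S (toDistribution h' φ) := by
      rw [hp, toDistribution_add, LineDeriv.lineDerivOp_add, ← mapCLM_toDistribution,
        ← mapCLM_toDistribution, lineDeriv_mapCLM, lineDeriv_mapCLM, hh']
      rfl
    have hpφ : toDistribution p φ = σ (toDistribution u φ) + S (toDistribution h φ) := by
      rw [hp, toDistribution_add, ← toDistribution_compLp_apply, ← toDistribution_compLp_apply]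
      rfl
    have hmφ : toDistribution m φ = E (toDistribution f φ - K (toDistribution p φ)) := by
      rw [hm, toDistribution_compLp_apply, toDistribution_sub, ← toDistribution_compLp_apply]
      rfl
    have hF : toDistribution ((kerRep B).compLp (g + (K.flip ∘L E).compLp f
        - (gelfandEmbedding ι ∘L S).compLp h' - (eliminatedOperator ι A K E ∘L S).compLp h)) φ
        = kerRep B (toDistribution g φ + (K.flip ∘L E) (toDistribution f φ)
          - (gelfandEmbedding ι ∘L S) (toDistribution h' φ)
          - (eliminatedOperator ι A K E ∘L S) (toDistribution h φ)) := by
      rw [toDistribution_compLp_apply, toDistribution_sub, toDistribution_sub, toDistribution_add,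
        ← toDistribution_compLp_apply, ← toDistribution_compLp_apply,
        ← toDistribution_compLp_apply]
      rfl
    have hU : kerRep B (gelfandEmbedding ι (σ (∂_{(1 : ℝ)} (toDistribution u) φ)))
        + kerRep B (eliminatedOperator ι A K E (σ (toDistribution u φ))) = _ :=
      Eq.trans (by
        rw [← mapCLM_toDistribution, lineDeriv_mapCLM, ← mapCLM_toDistribution]
        refine congrArg (· + _) ?_
        exact kerRep_gelfandEmbedding ι B _)
        ((congrArg (fun D : 𝓓'(timeInterval T, kerSpace B) => D φ) hu).trans hF)
    have hΨφ : Ψ φ = toDistribution g φ - restrictedOperator ι A (toDistribution p φ)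
        + K.flip (toDistribution m φ) - gelfandEmbedding ι (∂_{(1 : ℝ)} (toDistribution p) φ) := by
      rw [hΨ, lineDeriv_mapCLM, toDistribution_add, toDistribution_sub,
        ← toDistribution_compLp_apply, ← toDistribution_compLp_apply]
      rfl
    rw [← map_add, ← sub_eq_zero, ← map_sub] at hU
    rw [← neg_eq_zero, ← map_neg, ← hU, hΨφ, hmφ, hpd, hpφ]
    congr 1
    simp only [eliminatedOperator, map_add, map_sub, add_apply, ContinuousLinearMap.comp_apply]
    abel
  have hBR : ∀ φ, B.flip (R (Ψ φ)) = Ψ φ := fun φ =>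
    hR _ (apply_eq_zero_of_kerRep_eq_zero (hΨ0 φ))
  refine ⟨p, m, Distribution.mapCLM R Ψ, ?_, ?_, ?_, ?_⟩
  · have h1 : Distribution.mapCLM B.flip (Distribution.mapCLM R Ψ) = Ψ :=
      ContinuousLinearMap.ext hBR
    rw [derivAddMultiplier, h1, hΨ, toDistribution_add _ (K.flip.compLp m), toDistribution_sub,
      mapCLM_toDistribution (restrictedOperator ι A), mapCLM_toDistribution K.flip]
    abel
  · filter_upwards [E.coeFn_compLp (f - K.compLp p), Lp.coeFn_sub f (K.compLp p),
      K.coeFn_compLp p] with t h1 h2 h3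
    rw [hm, h1, hE, h2, Pi.sub_apply, h3, add_sub_cancel]
  · filter_upwards [hpae] with t h1
    have h2 : B (u t) = 0 := (u t).2
    rw [h1, map_add, h2, hS, zero_add]
  · refine ⟨fun t => v t + ι (S (hc t)), hv.add ((ι ∘L S).continuous.comp_continuousOn hhc), ?_, ?_⟩
    · filter_upwards [hpae, huv, hhae] with t h1 h2 h3
      rw [h1, ← h2, ← h3, map_add]
      rfl
    · simp only [hv0, hhc0, sub_add_cancel]

/-- The difference `d` of two potentials lies in `ker B` and starts at `0`. Eliminating the flux and
restricting to `ker B` leaves the homogeneous parabolic problem, so `d = 0`; the flux and multiplier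
differences then vanish too. -/
theorem IsWeakSolution.unique (hT : 0 < T) {ι : P →L[ℝ] H} (hι : Function.Injective ι)
    {A : H →L[ℝ] StrongDual ℝ H} {K : P →L[ℝ] StrongDual ℝ M} {D : M →L[ℝ] StrongDual ℝ M}
    {B : P →L[ℝ] StrongDual ℝ Q} (hD : IsElliptic D)
    (hK : ∃ c : ℝ, 0 < c ∧ ∀ q ∈ kerSpace B, c * ‖q‖ ≤ ‖K q‖)
    {E : StrongDual ℝ M →L[ℝ] M} (hE : ∀ ξ, D (E ξ) = ξ) (hE' : ∀ m, E (D m) = m)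
    {R : StrongDual ℝ P →L[ℝ] Q} (hR : ∀ μ, R (B.flip μ) = μ)
    {f : L2 T (StrongDual ℝ M)} {g : L2 T (StrongDual ℝ P)} {h : L2 T (StrongDual ℝ Q)}
    {pInit : H} {p p' : L2 T P} {m m' : L2 T M} {lam lam' : 𝓓'(timeInterval T, Q)}
    (hs : IsWeakSolution ι A K D B f g h pInit p m lam)
    (hs' : IsWeakSolution ι A K D B f g h pInit p' m' lam') :
    p = p' ∧ m = m' ∧ lam = lam' := by
  obtain ⟨α, C, hα, hC, ha⟩ := kerOperator_garding ι A hD hE hK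
  set σ : kerSpace B →L[ℝ] P := (kerSpace B).subtypeL with hσ
  set d := p - p' with hd
  have hdae : ∀ᵐ t ∂(timeMeasure T), d t = p t - p' t := Lp.coeFn_sub p p'
  -- As `d` takes values in `ker B` almost everywhere, the projection changes nothing but the
  -- codomain.
  set u : L2 T (kerSpace B) := (kerSpace B).orthogonalProjectionOnto.compLp d with hu
  have hud : ∀ᵐ t ∂(timeMeasure T), (u t : P) = d t := by
    filter_upwards [hdae, (kerSpace B).orthogonalProjectionOnto.coeFn_compLp d, hs.constraint_eq,
      hs'.constraint_eq] with t h1 h2 h3 h4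
    have hmem : d t ∈ kerSpace B := by
      change B (d t) = 0
      rw [h1, map_sub, h3, h4, sub_self]
    rw [hu, h2]
    exact congrArg Subtype.val
      (Submodule.orthogonalProjectionOnto_mem_subspace_eq_self (⟨d t, hmem⟩ : kerSpace B))
  have hσu : σ.compLp u = d := by
    refine Lp.ext ?_
    filter_upwards [hud, σ.coeFn_compLp u] with t h1 h2
    rw [h2, ← h1]
    rfl
  have hmd : m - m' = -(E ∘L K).compLp d := by
    refine Lp.ext ?_
    filter_upwards [hdae, Lp.coeFn_sub m m', Lp.coeFn_neg ((E ∘L K).compLp d),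
      (E ∘L K).coeFn_compLp d, hs.flow_eq, hs'.flow_eq] with t h1 h2 h3 h4 h5 h6
    rw [h2, h3, Pi.neg_apply, h4, h1, Pi.sub_apply, ← hE' (m t - m' t),
      ContinuousLinearMap.comp_apply, ← map_neg, map_sub D, map_sub K]
    congr 1
    rw [← sub_eq_zero]
    have := h5.trans h6.symm
    rw [← sub_eq_zero] at this
    rw [← this]
    abel
  have heq : ∀ φ, gelfandEmbedding ι (∂_{(1 : ℝ)} (toDistribution d) φ) + B.flip ((lam - lam') φ)
      + eliminatedOperator ι A K E (toDistribution d φ) = 0 := fun φ => by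
    have h1 := hs.potential_eq.trans hs'.potential_eq.symm
    have h2 : derivAddMultiplier ι B p lam φ + restrictedOperator ι A (toDistribution p φ)
          - K.flip (toDistribution m φ)
        = derivAddMultiplier ι B p' lam' φ + restrictedOperator ι A (toDistribution p' φ)
          - K.flip (toDistribution m' φ) :=
      congrArg (fun D : 𝓓'(timeInterval T, StrongDual ℝ P) => D φ) h1
    have h3 : ∀ (q : L2 T P) (ν : 𝓓'(timeInterval T, Q)), derivAddMultiplier ι B q ν φ
        = gelfandEmbedding ι (∂_{(1 : ℝ)} (toDistribution q) φ) + B.flip (ν φ) := fun q ν => by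
      rw [derivAddMultiplier, lineDeriv_mapCLM]
      rfl
    have h4 : ∂_{(1 : ℝ)} (toDistribution p) φ
        = ∂_{(1 : ℝ)} (toDistribution d) φ + ∂_{(1 : ℝ)} (toDistribution p') φ := by
      rw [← sub_add_cancel p p', ← hd, toDistribution_add, LineDeriv.lineDerivOp_add]
      rfl
    have h5 : toDistribution p φ = toDistribution d φ + toDistribution p' φ := by
      rw [← sub_add_cancel p p', ← hd, toDistribution_add]
      rfl
    have h6 : toDistribution m φ = toDistribution m' φ - E (K (toDistribution d φ)) := by
      have h7 : m = m' - (E ∘L K).compLp d := by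
        rw [← sub_add_cancel m m', hmd]
        abel
      rw [h7, toDistribution_sub, ← ContinuousLinearMap.comp_apply, ← toDistribution_compLp_apply]
      rfl
    rw [h3, h3, h4, h5, h6, ← sub_eq_zero] at h2
    have h8 : (lam - lam') φ = lam φ - lam' φ := rfl
    rw [h8, ← h2]
    simp only [eliminatedOperator, map_add, map_sub, add_apply, ContinuousLinearMap.comp_apply]
    abel
  have hu0 : u = 0 := by
    refine parabolic_solution_eq_zero hT (ι ∘L σ) (hι.comp Subtype.val_injective)
      (kerOperator ι A K E B) hα hC ha ?_ ?_
    · ext1 φ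
      have h1 := congrArg (kerRep B) (heq φ)
      have h2 : ∂_{(1 : ℝ)} (toDistribution d) φ = σ (∂_{(1 : ℝ)} (toDistribution u) φ) := by
        rw [← hσu, ← mapCLM_toDistribution, lineDeriv_mapCLM]
        rfl
      have h3 : toDistribution d φ = σ (toDistribution u φ) := by
        rw [← hσu, toDistribution_compLp_apply]
      rw [h2, h3, map_add, map_add, kerRep_flip, add_zero, map_zero] at h1
      refine Eq.trans ?_ h1
      rw [← mapCLM_toDistribution _ u, lineDeriv_mapCLM, ← mapCLM_toDistribution _ u]
      exact congrArg (· + _) (kerRep_gelfandEmbedding ι B _).symm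
    · obtain ⟨v, hv, hpv, hv0⟩ := hs.initial
      obtain ⟨v', hv', hpv', hv0'⟩ := hs'.initial
      refine ⟨fun t => v t - v' t, hv.sub hv', ?_, by simp only [hv0, hv0', sub_self]⟩
      filter_upwards [hud, hdae, hpv, hpv'] with t h1 h2 h3 h4
      rw [← h3, ← h4, ← map_sub, ← h2, ← h1]
      rfl
  have hd0 : d = 0 := by
    rw [← hσu, hu0]
    exact (σ.compLpL 2 (timeMeasure T)).map_zero
  refine ⟨sub_eq_zero.1 hd0, sub_eq_zero.1 ?_, sub_eq_zero.1 ?_⟩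
  · rw [hmd, hd0, neg_eq_zero]
    exact ((E ∘L K).compLpL 2 (timeMeasure T)).map_zero
  · ext1 φ
    have h1 := heq φ
    have h2 : ∂_{(1 : ℝ)} (0 : 𝓓'(timeInterval T, P)) φ = 0 := by simp
    have h3 : (0 : 𝓓'(timeInterval T, P)) φ = 0 := rfl
    -- With `d = 0` only `B* (lam - lam') = 0` remains, and `R` is a left inverse of `B*`.
    rw [hd0, toDistribution_zero, h2, h3, map_zero, map_zero, zero_add, add_zero] at h1
    rw [← hR ((lam - lam') φ), h1, map_zero]
    rfl

end WeakSolutions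

end

end PDAE


theorem proposition3p1
    {P H M Q : Type*}
    [NormedAddCommGroup P] [InnerProductSpace ℝ P] [CompleteSpace P]
    [NormedAddCommGroup H] [InnerProductSpace ℝ H] [CompleteSpace H]
    [NormedAddCommGroup M] [InnerProductSpace ℝ M] [CompleteSpace M]
    [NormedAddCommGroup Q] [InnerProductSpace ℝ Q] [CompleteSpace Q]
    (T : ℝ) (hT : 0 < T)
    -- the dense embedding of `P` into the pivot space `H`
    (ι : P →L[ℝ] H) (hι_inj : Function.Injective ι) (hι_dense : DenseRange ι)
    (A : H →L[ℝ] StrongDual ℝ H) (K : P →L[ℝ] StrongDual ℝ M)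
    (D : M →L[ℝ] StrongDual ℝ M) (B : P →L[ℝ] StrongDual ℝ Q)
    (hD : PDAE.IsElliptic D)
    (hB : PDAE.IsInfSupStable B)
    (hK : ∃ c : ℝ, 0 < c ∧ ∀ q ∈ PDAE.kerSpace B, c * ‖q‖ ≤ ‖K q‖)
    (f : PDAE.L2 T (StrongDual ℝ M)) (g : PDAE.L2 T (StrongDual ℝ P))
    (h : PDAE.L2 T (StrongDual ℝ Q)) (hh : PDAE.MemH1 h)
    -- the initial datum `pInit` and the value `h(0) = h₀`, with the consistency condition
    (pInit : H) (h₀ : StrongDual ℝ Q) (hh₀ : PDAE.IsContinuousWithInitialValue T h h₀)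
    (hcons : pInit - ι (PDAE.rightInverse B h₀) ∈ PDAE.kerClosure ι B) :
    ∃ (p₀ : PDAE.L2 T P) (m₀ : PDAE.L2 T M) (lam₀ : 𝓓'(PDAE.timeInterval T, Q)),
      PDAE.IsWeakSolution ι A K D B f g h pInit p₀ m₀ lam₀ ∧
      (∀ (p : PDAE.L2 T P) (m : PDAE.L2 T M) (lam : 𝓓'(PDAE.timeInterval T, Q)),
        PDAE.IsWeakSolution ι A K D B f g h pInit p m lam → p = p₀ ∧ m = m₀ ∧ lam = lam₀) ∧
      ∃ w : PDAE.L2 T (StrongDual ℝ P),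
        PDAE.derivAddMultiplier ι B p₀ lam₀ = PDAE.toDistribution w := by
  obtain ⟨E, hE, hE'⟩ := hD.exists_inverse
  obtain ⟨S, hS, hS'⟩ := hB.exists_rightInverse
  obtain ⟨R, hR, hR'⟩ := PDAE.exists_leftInverse_flip hS
  rw [PDAE.rightInverse_eq hS hS'] at hcons
  obtain ⟨p, m, lam, hs⟩ :=
    PDAE.exists_isWeakSolution hT ι hι_inj A hD hK hE hS hR' f g hh hh₀ hcons
  exact ⟨p, m, lam, hs, fun _ _ _ hs' => hs'.unique hT hι_inj hD hK hE hE' hR hs,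
    hs.exists_derivAddMultiplier_eq⟩
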